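/- **Definitions.** Let $G=(V,E)$ be a finite graph on $n$ vertices and let $k\ge 0$ be an integer. A $k$-coloring is any map $\sigma:V\to[k]$; it is proper if adjacent vertices receive different colors. For a $k$-coloring $\sigma$, $u\in V$ and $c\in[k]$, let the Kempe component $S_\sigma(u,c)$ be the set of vertices joined to $u$ by a path of $G$ along which the colors $\sigma(u)$ and $c$ alternate; flipping it means swapping the colors $\sigma(u)$ and $c$ on it. A sequence $\mathbf p=(p_1,p_2,\dots)$ of flip parameters is nonnegative and nonincreasing with $p_1=1$; it is bounded if $p_\ell=0$ for all sufficiently large $\ell$. Flip dynamics with flip parameters $\mathbf p$ is the Markov chain on all $k$-colorings of $G$ which, from $\sigma$, chooses $u\in V$ and $c\in[k]$ uniformly and independently, sets $\ell=|S_\sigma(u,c)|$, flips $S_\sigma(u,c)$ with probability $p_\ell/\ell$, and otherwise stays at $\sigma$. Let $P$ be its transition matrix and let $\pi$ be the uniform distribution on the proper $k$-colorings. The mixing time $t_{\mathrm{flip}(\mathbf p)}$ is the least $t$ such that $\max_\sigma\|P^t(\sigma,\cdot)-\pi\|_{TV}\le\frac14$, the maximum being over all $k$-colorings $\sigma$.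 **Theorem.** Let $\eta=\frac1{84000}$. The sequence $$\mathbf p^*=\left(1,\tfrac{185}{616},\tfrac16,\tfrac{47}{462},\tfrac{9}{154},\tfrac{2}{77},0,0,\dots\right)$$ is a bounded sequence of flip parameters with the following properties. 1. There is an absolute constant $\Delta_0$ such that for all integers $\Delta\ge\Delta_0$ and $k\ge\left(\frac{11}{6}-\eta\right)\Delta$ and every graph $G$ on $n$ vertices with maximum degree at most $\Delta$, the mixing time of flip dynamics for $k$-colorings of $G$ with flip parameters $\mathbf p^*$ is finite and satisfies $$t_{\mathrm{flip}(\mathbf p^*)}\le kn\log(4n).$$ 2. There is an absolute constant $C$ such that for all integers $\Delta\ge0$ and $k\ge\left(\frac{11}{6}-\eta\right)\Delta$ and every graph $G$ on $n$ vertices with maximum degree at most $\Delta$, this mixing time is finite and satisfies $$t_{\mathrm{flip}(\mathbf p^*)}\le C\,kn\log(4n).$$ (For $n=0$ the bounds are read as $0$.) -/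

import Mathlib

universe u

noncomputable section

namespace FlipDynamics

/-! ### Flip parameters -/

/-- The standing assumptions on flip parameters `p₁, p₂, …`: nonnegative, `p₁ = 1`, nonincreasing.
The value at index `0` is never used by the dynamics. -/
def IsFlipParameters (p : ℕ → ℝ) : Prop :=
  p 1 = 1 ∧ (∀ l, 1 ≤ l → p (l + 1) ≤ p l) ∧ ∀ l, 0 ≤ p l

/-- Flip parameters are bounded if they vanish from some index on. -/
def IsBounded (p : ℕ → ℝ) : Prop :=
  ∃ l₀ : ℕ, ∀ l, l₀ ≤ l → p l = 0

/-- The flip parameters `p* = (1, 185/616, 1/6, 47/462, 9/154, 2/77, 0, 0, …)`. -/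
def pStar : ℕ → ℝ
  | 1 => 1
  | 2 => 185 / 616
  | 3 => 1 / 6
  | 4 => 47 / 462
  | 5 => 9 / 154
  | 6 => 2 / 77
  | _ => 0

/-! ### Colorings and Kempe components -/

/-- A coloring, not necessarily proper, of the vertex set `V` with `k` colors. -/
abbrev Coloring (V : Type u) (k : ℕ) : Type u := V → Fin k

/-- A coloring is proper if adjacent vertices receive different colors. -/
def IsProper {V : Type u} {k : ℕ} (G : SimpleGraph V) (σ : Coloring V k) : Prop :=
  ∀ v w : V, G.Adj v w → σ v ≠ σ w

/-- The graph of the edges of `G` with one end of color `c₁` and the other of color `c₂`; its walks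
of positive length are the walks of `G` along which the colors `c₁` and `c₂` alternate. For
`c₁ = c₂` it consists of the edges that are monochromatic of this color. -/
def kempeGraph {V : Type u} {k : ℕ} (G : SimpleGraph V) (σ : Coloring V k) (c₁ c₂ : Fin k) :
    SimpleGraph V where
  Adj v w := G.Adj v w ∧ ((σ v = c₁ ∧ σ w = c₂) ∨ (σ v = c₂ ∧ σ w = c₁))
  symm := ⟨fun _ _ h => ⟨h.1.symm, h.2.symm.imp (fun h => h.symm) (fun h => h.symm)⟩⟩
  loopless := ⟨fun v h => G.loopless.irrefl v h.1⟩

open Classical in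
/-- The Kempe component `S_σ(u, c)`: the vertices joined to `u` by a path on which the colors
`σ u` and `c` alternate. -/
def kempeComponent {V : Type u} [Fintype V] {k : ℕ} (G : SimpleGraph V) (σ : Coloring V k)
    (u : V) (c : Fin k) : Finset V :=
  Finset.univ.filter fun w => (kempeGraph G σ (σ u) c).Reachable u w

open Classical in
/-- The coloring obtained from `σ` by flipping `S_σ(u, c)`, that is, by swapping the colors
`σ u` and `c` on it. -/
def flip {V : Type u} [Fintype V] {k : ℕ} (G : SimpleGraph V) (σ : Coloring V k)
    (u : V) (c : Fin k) : Coloring V k := fun v =>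
  if v ∈ kempeComponent G σ u c then
    if σ v = σ u then c else σ u
  else σ v

/-! ### Flip dynamics -/

open Classical in
/-- The transition matrix of flip dynamics on all colorings: choose a vertex `u` and a color `c`
uniformly and independently, let `l` be the size of `S_σ(u, c)`, move to the flipped coloring with
probability `p l / l`, and stay at `σ` otherwise. -/
def transition {V : Type u} [Fintype V] (G : SimpleGraph V) (k : ℕ) (p : ℕ → ℝ) :
    Matrix (Coloring V k) (Coloring V k) ℝ := fun σ σ' =>
  (1 / ((Fintype.card V : ℝ) * (k : ℝ))) * ∑ u : V, ∑ c : Fin k,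
    (p (kempeComponent G σ u c).card / ((kempeComponent G σ u c).card : ℝ) *
        (if σ' = flip G σ u c then 1 else 0) +
      (1 - p (kempeComponent G σ u c).card / ((kempeComponent G σ u c).card : ℝ)) *
        (if σ' = σ then 1 else 0))

open Classical in
/-- The uniform distribution on the proper colorings, as a distribution on all colorings. -/
def uniformProper {V : Type u} [Fintype V] (G : SimpleGraph V) (k : ℕ) : Coloring V k → ℝ :=
  fun σ => if IsProper G σ then
    1 / ((Finset.univ.filter fun τ : Coloring V k => IsProper G τ).card : ℝ) else 0

/-! ### Mixing times -/

/-- Total variation distance: the largest value of `|μ(A) - ν(A)|` over all events `A`. -/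
def tvDist {S : Type u} [Fintype S] (μ ν : S → ℝ) : ℝ :=
  ⨆ A : Finset S, |∑ s ∈ A, μ s - ∑ s ∈ A, ν s|

/-- The largest total variation distance to `π` after `t` steps, over all starting states. -/
def worstDist {S : Type u} [Fintype S] [DecidableEq S] (P : Matrix S S ℝ) (π : S → ℝ)
    (t : ℕ) : ℝ :=
  ⨆ s : S, tvDist ((P ^ t) s) π

/-- `t` is the mixing time: the least time at which the worst distance to `π` is at most `1/4`. -/
def IsMixingTime {S : Type u} [Fintype S] [DecidableEq S] (P : Matrix S S ℝ) (π : S → ℝ)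
    (t : ℕ) : Prop :=
  IsLeast {t : ℕ | worstDist P π t ≤ 1 / 4} t

open Classical in
/-- Flip dynamics for `k`-colorings of `G` with flip parameters `p` has mixing time at most `T`.
In particular a mixing time exists. -/
def FlipMixesWithin {V : Type u} [Fintype V] (G : SimpleGraph V) (k : ℕ) (p : ℕ → ℝ)
    (T : ℝ) : Prop :=
  ∃ t : ℕ, IsMixingTime (transition G k p) (uniformProper G k) t ∧ (t : ℝ) ≤ T

end FlipDynamics

end

/-! The proof is path coupling in dual form. Pairs of colorings that differ at one vertex `v` get a
weight in `[1/2, 1]`. If `f` changes by at most the weight along every such pair, then one step of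
the chain turns `f` into a function with Lipschitz constant `1 - c/(nk)`. Indicators of events have
constant at most `2` and any two colorings are joined by at most `n` such pairs, so indicators are
nearly constant after about `nk log(8n)/c` steps (`worstDist_le_of_contraction`). The uniform
distribution on proper colorings is stationary by detailed balance, so this bounds the total
variation distance.

One step is analyzed through the generator, in which each Kempe component of size `l` is flipped at
rate `p_l`. Let `σ` and `τ` differ at `v`, and let `c` be a color other than the two colors of `v`.
The component of `v` in `σ` for `c` consists of `v` and the components ("branches") that the
neighbors of `v` of color `c` have in `τ`, and conversely. The flip of the whole component is paired
with the flip of its largest branch in the other coloring. What is left of the rates of the branches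
is paired at each neighbor, which saves one unit per paired rate because the two branches share that
neighbor. For `p*` a color on `m > 0` neighbors then costs at most `(11/6)m - 1` (`cost_le`): a
finite check for `m ≤ 2`, a crude estimate for `m ≥ 3`. A color on no neighbor contributes `-1`. In
sum, the drift is at most `(11/6)Δ - k`, which is the classical threshold.

To go below `11/6`, note that a neighbor `u` saves `1/264` unless its two branches have sizes other
than `(1,1)` with sum at most `4`. In those exceptional cases `u` has one or two "busy" neighbors,
that is, neighbors other than `v` with a color of `v` (`isSlack_of_card_busy`). Such a situation
does not persist: a busy neighbor is recolored with a harmless color at rate at least `k - Δ - 2`,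
while new ones appear at rate at most `2Δ`. The weight of an edge is therefore `1 - γ ∑
discount(N_u)`, with `N_u` the number of busy neighbors of `u` and discounts `16/15, 1/15, 0, 0, …`.
When `N_u` is `1` or `2`, the expected growth of the discount is a strict gain; when `N_u = 0`, the
possible loss of the discount and the price of carrying it are paid from `1/264`; when `N_u ≥ 3`
there is nothing to pay. This gives a gain proportional to `Δ` for `Δ ≥ 6`. For `Δ < 6` the plain
`11/6` bound suffices, by integrality. -/

noncomputable section

namespace FlipDynamics

/-! ### Numerical facts about the flip parameters -/

/-- The flip parameters `p*` scaled by `1848` to natural numbers. -/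
def pScaled : ℕ → ℕ
  | 1 => 1848
  | 2 => 555
  | 3 => 308
  | 4 => 188
  | 5 => 108
  | 6 => 48
  | _ => 0

theorem pScaled_of_le {a : ℕ} (h : 7 ≤ a) : pScaled a = 0 := by
  obtain ⟨b, rfl⟩ := Nat.exists_eq_add_of_le' h
  rfl

theorem pStar_eq (a : ℕ) : pStar a = (pScaled a : ℝ) / 1848 := by
  rcases le_or_gt 7 a with h | h
  · rw [pScaled_of_le h]
    obtain ⟨b, rfl⟩ := Nat.exists_eq_add_of_le' h
    simp [pStar]
  · interval_cases a <;> norm_num [pStar, pScaled]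

theorem pStar_of_le {a : ℕ} (h : 7 ≤ a) : pStar a = 0 := by
  rw [pStar_eq, pScaled_of_le h]; simp

theorem pStar_nonneg (a : ℕ) : 0 ≤ pStar a := by
  rw [pStar_eq]; positivity

theorem pStar_succ_le {a : ℕ} (h : 1 ≤ a) : pStar (a + 1) ≤ pStar a := by
  rcases le_or_gt 7 a with h' | h'
  · rw [pStar_of_le h', pStar_of_le (by omega)]
  · interval_cases a <;> norm_num [pStar]

theorem pStar_anti {a b : ℕ} (h : 1 ≤ a) (hab : a ≤ b) : pStar b ≤ pStar a := by
  induction b, hab using Nat.le_induction with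
  | base => exact le_rfl
  | succ n hn ih => exact (pStar_succ_le (h.trans hn)).trans ih

theorem pStar_le_one (a : ℕ) : pStar a ≤ 1 := by
  rcases le_or_gt 7 a with h' | h'
  · rw [pStar_of_le h']; norm_num
  · interval_cases a <;> norm_num [pStar]

theorem isFlipParameters_pStar : IsFlipParameters pStar :=
  ⟨rfl, fun _ h => pStar_succ_le h, pStar_nonneg⟩

theorem isBounded_pStar : IsBounded pStar := ⟨7, fun _ h => pStar_of_le h⟩

theorem mul_pStar_le_one (a : ℕ) : (a : ℝ) * pStar a ≤ 1 := by
  rcases le_or_gt 7 a with h' | h'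
  · rw [pStar_of_le h']; norm_num
  · interval_cases a <;> norm_num [pStar]

/-- The maximum is at `a = 2`. This applies to components that contain two neighbors of `v`. -/
theorem mul_pStar_le {a : ℕ} (h : 2 ≤ a) : (a : ℝ) * pStar a ≤ 185 / 308 := by
  rcases le_or_gt 7 a with h' | h'
  · rw [pStar_of_le h']; norm_num
  · interval_cases a <;> norm_num [pStar]

theorem sub_one_mul_pStar_le (a : ℕ) : ((a : ℝ) - 1) * pStar a ≤ 1 / 3 := by
  rcases le_or_gt 7 a with h' | h'
  · rw [pStar_of_le h']; norm_num
  · interval_cases a <;> norm_num [pStar]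

/-- The maximum is at `a = 4`. -/
theorem sub_two_mul_pStar_le (a : ℕ) : ((a : ℝ) - 2) * pStar a ≤ 94 / 462 := by
  rcases le_or_gt 7 a with h' | h'
  · rw [pStar_of_le h']; norm_num
  · interval_cases a <;> norm_num [pStar]

/-- Sizes above `7` may be replaced by `7`. -/
theorem mul_pStar_min (a : ℕ) : (a : ℝ) * pStar a = ((min a 7 : ℕ) : ℝ) * pStar (min a 7) := by
  rcases le_or_gt 7 a with h | h
  · rw [min_eq_right h, pStar_of_le h, pStar_of_le le_rfl]; simp
  · rw [min_eq_left h.le]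

theorem pStar_min (a : ℕ) : pStar a = pStar (min a 7) := by
  rcases le_or_gt 7 a with h | h
  · rw [min_eq_right h, pStar_of_le h, pStar_of_le le_rfl]
  · rw [min_eq_left h.le]

/-- The configurations of a neighbor that are certainly not extremal. -/
def IsSlack (a b : ℕ) : Prop := (a = 1 ∧ b = 1) ∨ 5 ≤ a + b

instance (a b : ℕ) : Decidable (IsSlack a b) := by unfold IsSlack; infer_instance

/-- The cost of a color that appears on one neighbor. -/
theorem cost_one {a b : ℕ} (ha : 1 ≤ a) (hb : 1 ≤ b) :
    a * (pStar a - pStar (1 + a)) + b * (pStar b - pStar (1 + b))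
      - min (pStar a - pStar (1 + a)) (pStar b - pStar (1 + b))
      ≤ 5 / 6 - (if IsSlack a b then 1 / 264 else 0) := by
  -- Scaling by `1848`, the common denominator, turns `5/6` into `1540` and `1/264` into `7`. Sizes
  -- from `7` on have rate `0` and behave alike, so 49 cases remain.
  have key : ∀ a b : Fin 7,
      (a.val + 1) * (pScaled (a + 1) - pScaled (1 + (a + 1)) : ℤ)
        + (b.val + 1) * (pScaled (b + 1) - pScaled (1 + (b + 1)) : ℤ)
      - min (pScaled (a + 1) - pScaled (1 + (a + 1)) : ℤ)
          (pScaled (b + 1) - pScaled (1 + (b + 1)) : ℤ)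
      ≤ 1540 - (if IsSlack (a + 1) (b + 1) then 7 else 0) := by decide +kernel
  have clip : ∀ a : ℕ, 1 ≤ a → ∃ i : Fin 7, (i : ℕ) + 1 = min a 7 ∧
      (a : ℝ) * (pStar a - pStar (1 + a))
        = ((i : ℕ) + 1) * ((pScaled (i + 1) : ℝ) - pScaled (1 + (i + 1))) / 1848 ∧
      pStar a - pStar (1 + a) = ((pScaled (i + 1) : ℝ) - pScaled (1 + (i + 1))) / 1848 := by
    intro a ha
    refine ⟨⟨min a 7 - 1, by omega⟩, by simp; omega, ?_⟩
    have e : min a 7 - 1 + 1 = min a 7 := by omega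
    simp only [e]
    rcases le_or_gt 7 a with h | h
    · rw [min_eq_right h, pStar_of_le h, pStar_of_le (by omega)]
      norm_num [pScaled]
    · have e2 : ((min a 7 - 1 : ℕ) : ℝ) + 1 = a := by
        rw [min_eq_left h.le]; push_cast [Nat.cast_sub ha]; ring
      rw [e2, min_eq_left h.le, pStar_eq, pStar_eq]
      constructor <;> ring
  obtain ⟨i, hi, ha1, ha2⟩ := clip a ha
  obtain ⟨j, hj, hb1, hb2⟩ := clip b hb
  have hs : IsSlack a b → IsSlack (i + 1) (j + 1) := by unfold IsSlack; omega
  have := key i j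
  rw [ha1, hb1, ha2, hb2, min_div_div_right (by norm_num : (0 : ℝ) ≤ 1848)]
  have h2 : (((i.val + 1) * (pScaled (i + 1) - pScaled (1 + (i + 1)) : ℤ)
        + (j.val + 1) * (pScaled (j + 1) - pScaled (1 + (j + 1)) : ℤ)
      - min (pScaled (i + 1) - pScaled (1 + (i + 1)) : ℤ)
          (pScaled (j + 1) - pScaled (1 + (j + 1)) : ℤ) : ℤ) : ℝ)
      ≤ ((1540 - (if IsSlack (i + 1) (j + 1) then 7 else 0) : ℤ) : ℝ) := by exact_mod_cast this
  push_cast at h2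
  have h3 : (if IsSlack a b then (1 : ℝ) / 264 else 0)
      ≤ (if IsSlack (i + 1) (j + 1) then (7 : ℝ) else 0) / 1848 := by
    by_cases h : IsSlack a b
    · rw [if_pos h, if_pos (hs h)]; norm_num
    · rw [if_neg h]; positivity
  linarith

/-- The cost of a color that appears on two neighbors, with sizes at most `7` and scaled by `1848`;
`e₁` and `e₂` are the amounts taken from the rates of the two components on one side. -/
def scaledCost (a₁ a₂ b₁ b₂ : ℕ) (pA e₁ e₂ : ℤ) : ℤ :=
  pA * a₂ + e₁ * b₂ + e₂ * b₁ + a₁ * (pScaled a₁ - pA) + a₂ * pScaled a₂ + b₁ * (pScaled b₁ - e₁)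
    + b₂ * (pScaled b₂ - e₂) - min (pScaled a₁ - pA : ℤ) (pScaled b₁ - e₁)
    - min (pScaled a₂ : ℤ) (pScaled b₂ - e₂)

/-- A finite check: `4928 = 1848 * 8/3` and `14 = 1848 * 2/264`. The first neighbor carries the
largest branch on the `a` side; the two clauses are the two positions of the largest branch on the
`b` side. -/
theorem scaledCost_le : ∀ a₁ a₂ b₁ b₂ : Fin 7, a₂ ≤ a₁ →
    (b₂ ≤ b₁ → scaledCost (a₁ + 1) (a₂ + 1) (b₁ + 1) (b₂ + 1)
        (pScaled (1 + (a₁ + 1) + (a₂ + 1))) (pScaled (1 + (b₁ + 1) + (b₂ + 1))) 0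
      ≤ 4928 - (if IsSlack (a₁ + 1) (b₁ + 1) ∨ IsSlack (a₂ + 1) (b₂ + 1) then 14 else 0)) ∧
    (b₁ ≤ b₂ → scaledCost (a₁ + 1) (a₂ + 1) (b₁ + 1) (b₂ + 1)
        (pScaled (1 + (a₁ + 1) + (a₂ + 1))) 0 (pScaled (1 + (b₁ + 1) + (b₂ + 1)))
      ≤ 4928 - (if IsSlack (a₁ + 1) (b₁ + 1) ∨ IsSlack (a₂ + 1) (b₂ + 1) then 14 else 0)) := by
  decide +kernel

theorem exists_fin_eq_min {a : ℕ} (ha : 1 ≤ a) : ∃ i : Fin 7, (i : ℕ) + 1 = min a 7 :=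
  ⟨⟨min a 7 - 1, by omega⟩, by simp; omega⟩

theorem pStar_clip {a i : ℕ} (h : i + 1 = min a 7) :
    pStar a = pScaled (i + 1) / 1848 ∧ (a : ℝ) * pStar a = (i + 1) * pScaled (i + 1) / 1848 := by
  constructor
  · rw [pStar_min, ← h, pStar_eq]
  · rw [mul_pStar_min, ← h, pStar_eq]; push_cast; ring

/-- Either `1 + a + b ≥ 7`, and then the sum of the clipped sizes is at least `7` too and both rates
vanish, or neither size is clipped. -/
theorem pStar_clip_add {a b i j : ℕ} (h : i + 1 = min a 7) (h' : j + 1 = min b 7) :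
    pStar (1 + a + b) = pScaled (1 + (i + 1) + (j + 1)) / 1848 ∧
    pStar (1 + a + b) * a = pScaled (1 + (i + 1) + (j + 1)) * (i + 1) / 1848 ∧
    pStar (1 + a + b) * b = pScaled (1 + (i + 1) + (j + 1)) * (j + 1) / 1848 := by
  rcases le_or_gt 7 (1 + a + b) with hab | hab
  · rw [pStar_of_le hab, pScaled_of_le (by omega)]; simp
  · have ha : a = i + 1 := by omega
    have hb : b = j + 1 := by omega
    subst ha hb
    rw [pStar_eq]; push_cast
    refine ⟨rfl, by ring, by ring⟩

theorem cost_two_aux {a₁ a₂ b₁ b₂ : ℕ} (ha₁ : 1 ≤ a₁) (ha₂ : 1 ≤ a₂) (hb₁ : 1 ≤ b₁) (hb₂ : 1 ≤ b₂)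
    (ha : a₂ ≤ a₁) :
    (b₂ ≤ b₁ → pStar (1 + a₁ + a₂) * a₂ + pStar (1 + b₁ + b₂) * b₂
        + a₁ * (pStar a₁ - pStar (1 + a₁ + a₂)) + a₂ * pStar a₂
        + b₁ * (pStar b₁ - pStar (1 + b₁ + b₂)) + b₂ * pStar b₂
        - min (pStar a₁ - pStar (1 + a₁ + a₂)) (pStar b₁ - pStar (1 + b₁ + b₂))
        - min (pStar a₂) (pStar b₂)
      ≤ 8 / 3 - (if IsSlack a₁ b₁ ∨ IsSlack a₂ b₂ then 2 / 264 else 0)) ∧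
    (b₁ ≤ b₂ → pStar (1 + a₁ + a₂) * a₂ + pStar (1 + b₁ + b₂) * b₁
        + a₁ * (pStar a₁ - pStar (1 + a₁ + a₂)) + a₂ * pStar a₂
        + b₁ * pStar b₁ + b₂ * (pStar b₂ - pStar (1 + b₁ + b₂))
        - min (pStar a₁ - pStar (1 + a₁ + a₂)) (pStar b₁)
        - min (pStar a₂) (pStar b₂ - pStar (1 + b₁ + b₂))
      ≤ 8 / 3 - (if IsSlack a₁ b₁ ∨ IsSlack a₂ b₂ then 2 / 264 else 0)) := by
  obtain ⟨i₁, hi₁⟩ := exists_fin_eq_min ha₁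
  obtain ⟨i₂, hi₂⟩ := exists_fin_eq_min ha₂
  obtain ⟨j₁, hj₁⟩ := exists_fin_eq_min hb₁
  obtain ⟨j₂, hj₂⟩ := exists_fin_eq_min hb₂
  obtain ⟨p₁, q₁⟩ := pStar_clip hi₁
  obtain ⟨p₂, q₂⟩ := pStar_clip hi₂
  obtain ⟨r₁, s₁⟩ := pStar_clip hj₁
  obtain ⟨r₂, s₂⟩ := pStar_clip hj₂
  obtain ⟨pA, pA₁, pA₂⟩ := pStar_clip_add hi₁ hi₂
  obtain ⟨pB, pB₁, pB₂⟩ := pStar_clip_add hj₁ hj₂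
  have key := scaledCost_le i₁ i₂ j₁ j₂ (by rw [Fin.le_def]; omega)
  have hs : IsSlack a₁ b₁ ∨ IsSlack a₂ b₂ →
      IsSlack (i₁ + 1) (j₁ + 1) ∨ IsSlack (i₂ + 1) (j₂ + 1) := by unfold IsSlack; omega
  have h3 : (if IsSlack a₁ b₁ ∨ IsSlack a₂ b₂ then (2 : ℝ) / 264 else 0)
      ≤ (if IsSlack (i₁ + 1) (j₁ + 1) ∨ IsSlack (i₂ + 1) (j₂ + 1) then (14 : ℝ) else 0)
        / 1848 := by
    by_cases h : IsSlack a₁ b₁ ∨ IsSlack a₂ b₂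
    · rw [if_pos h, if_pos (hs h)]; norm_num
    · rw [if_neg h]; positivity
  have hmin : ∀ x y : ℝ, min (x / 1848) (y / 1848) = min x y / 1848 :=
    fun x y => min_div_div_right (by norm_num) x y
  constructor
  · intro hb
    have h2 := key.1 (by rw [Fin.le_def]; omega)
    rw [scaledCost, ← Int.cast_le (R := ℝ)] at h2
    push_cast at h2
    have e₁ : pStar a₁ - pStar (1 + a₁ + a₂)
        = ((pScaled (i₁ + 1) : ℝ) - pScaled (1 + (i₁ + 1) + (i₂ + 1))) / 1848 := by
      rw [p₁, pA]; ring
    have e₂ : pStar b₁ - pStar (1 + b₁ + b₂)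
        = ((pScaled (j₁ + 1) : ℝ) - pScaled (1 + (j₁ + 1) + (j₂ + 1))) / 1848 := by
      rw [r₁, pB]; ring
    have m₁ : min (pStar a₁ - pStar (1 + a₁ + a₂)) (pStar b₁ - pStar (1 + b₁ + b₂)) = min
        ((pScaled (i₁ + 1) : ℝ) - pScaled (1 + (i₁ + 1) + (i₂ + 1)))
        ((pScaled (j₁ + 1) : ℝ) - pScaled (1 + (j₁ + 1) + (j₂ + 1))) / 1848 := by
      rw [e₁, e₂, hmin]
    have m₂ : min (pStar a₂) (pStar b₂)
        = min (pScaled (i₂ + 1) : ℝ) (pScaled (j₂ + 1)) / 1848 := by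
      rw [p₂, r₂, hmin]
    rw [m₁, m₂]
    simp only [sub_zero] at h2
    linarith
  · intro hb
    have h2 := key.2 (by rw [Fin.le_def]; omega)
    rw [scaledCost, ← Int.cast_le (R := ℝ)] at h2
    push_cast at h2
    have e₁ : pStar a₁ - pStar (1 + a₁ + a₂)
        = ((pScaled (i₁ + 1) : ℝ) - pScaled (1 + (i₁ + 1) + (i₂ + 1))) / 1848 := by
      rw [p₁, pA]; ring
    have e₂ : pStar b₂ - pStar (1 + b₁ + b₂)
        = ((pScaled (j₂ + 1) : ℝ) - pScaled (1 + (j₁ + 1) + (j₂ + 1))) / 1848 := by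
      rw [r₂, pB]; ring
    have m₁ : min (pStar a₁ - pStar (1 + a₁ + a₂)) (pStar b₁) = min
        ((pScaled (i₁ + 1) : ℝ) - pScaled (1 + (i₁ + 1) + (i₂ + 1))) (pScaled (j₁ + 1)) / 1848 := by
      rw [e₁, r₁, hmin]
    have m₂ : min (pStar a₂) (pStar b₂ - pStar (1 + b₁ + b₂)) = min (pScaled (i₂ + 1) : ℝ)
        ((pScaled (j₂ + 1) : ℝ) - pScaled (1 + (j₁ + 1) + (j₂ + 1))) / 1848 := by
      rw [e₂, p₂, hmin]
    rw [m₁, m₂]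
    simp only [sub_zero] at h2
    linarith

/-! ### The cost of one color -/

/-- The number of indices in `U` with the same key as `u`. -/
def mult {ι X : Type*} [DecidableEq X] (U : Finset ι) (x : ι → X) (u : ι) : ℕ :=
  (U.filter fun w => x w = x u).card

section Mult

variable {ι X : Type*} [DecidableEq X] {U : Finset ι} {x : ι → X}

theorem mult_pos {u : ι} (hu : u ∈ U) : 0 < mult U x u :=
  Finset.card_pos.2 ⟨u, Finset.mem_filter.2 ⟨hu, rfl⟩⟩

theorem one_le_mult {u : ι} (hu : u ∈ U) : (1 : ℝ) ≤ mult U x u := by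
  exact_mod_cast mult_pos (x := x) hu

/-- The indices with a given key share its value equally, so each key counts once. -/
theorem sum_div_mult (U : Finset ι) (x : ι → X) (F : X → ℝ) :
    ∑ u ∈ U, F (x u) / mult U x u = ∑ z ∈ U.image x, F z := by
  rw [← Finset.sum_fiberwise_of_maps_to (fun u hu => Finset.mem_image_of_mem x hu)]
  refine Finset.sum_congr rfl fun z hz => ?_
  obtain ⟨w, hw, rfl⟩ := Finset.mem_image.1 hz
  have : ∀ u ∈ U.filter (fun u => x u = x w), F (x u) / mult U x u = F (x w) / mult U x w := by
    intro u hu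
    have := (Finset.mem_filter.1 hu).2
    simp only [mult, this]
  rw [Finset.sum_congr rfl this, Finset.sum_const, nsmul_eq_mul]
  have h := mult_pos (x := x) hw
  rw [← mult]
  field_simp

theorem sum_ite_div_mult {o : ι} (ho : o ∈ U) (c : ℝ) :
    ∑ u ∈ U, (if x u = x o then c else 0) / mult U x u = c := by
  rw [sum_div_mult U x (fun z => if z = x o then c else 0), Finset.sum_ite_eq',
    if_pos (Finset.mem_image_of_mem x ho)]

end Mult

/-- The components hanging off a vertex towards the neighbors in `U`, with their sizes, a largest
one, and the size of the component that they form together with the vertex. -/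
structure Branches {ι : Type*} (X : Type*) [DecidableEq X] (U : Finset ι) where
  key : ι → X
  size : ι → ℕ
  top : ι
  total : ℕ
  size_congr : ∀ u ∈ U, ∀ w ∈ U, key u = key w → size u = size w
  top_mem : top ∈ U
  size_le_top : ∀ u ∈ U, size u ≤ size top
  mult_le : ∀ u ∈ U, mult U key u ≤ size u
  total_eq : (total : ℝ) = 1 + ∑ u ∈ U, (size u : ℝ) / mult U key u

namespace Branches

variable {ι X : Type*} [DecidableEq X] {U : Finset ι} (S : Branches X U)

/-- The share of an index in the rate of its component. -/
def rate (u : ι) : ℝ := pStar (S.size u) / mult U S.key u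

/-- The part of `rate` that is left after the rate of the whole component is taken from the
largest branch. -/
def leftover (u : ι) : ℝ :=
  S.rate u - (if S.key u = S.key S.top then pStar S.total else 0) / mult U S.key u

theorem one_le_size {u : ι} (hu : u ∈ U) : 1 ≤ S.size u :=
  (mult_pos hu).trans_le (S.mult_le u hu)

theorem rate_le {u : ι} (hu : u ∈ U) : S.rate u ≤ pStar (S.size u) :=
  div_le_self (pStar_nonneg _) (one_le_mult hu)

/-- The summand `1` in `total_eq` makes this strict. Since the parameters decrease, the rate of the
whole component can be taken out of the rate of its largest branch. -/
theorem size_top_lt : S.size S.top < S.total := by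
  have h : (S.size S.top : ℝ) ≤ ∑ u ∈ U, (S.size u : ℝ) / mult U S.key u := by
    rw [← sum_ite_div_mult (x := S.key) S.top_mem (S.size S.top : ℝ)]
    refine Finset.sum_le_sum fun u hu => ?_
    gcongr
    split_ifs with h
    · rw [S.size_congr u hu _ S.top_mem h]
    · positivity
  have := S.total_eq
  have : (S.size S.top : ℝ) < S.total := by linarith
  exact_mod_cast this

theorem leftover_nonneg {u : ι} (hu : u ∈ U) : 0 ≤ S.leftover u := by
  rw [leftover, rate, ← sub_div]
  refine div_nonneg (sub_nonneg.2 ?_) (Nat.cast_nonneg _)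
  split_ifs with h
  · rw [S.size_congr u hu _ S.top_mem h]
    exact pStar_anti (S.one_le_size S.top_mem) S.size_top_lt.le
  · exact pStar_nonneg _

theorem leftover_le {u : ι} : S.leftover u ≤ S.rate u := by
  rw [leftover]
  have : 0 ≤ (if S.key u = S.key S.top then pStar S.total else 0) / (mult U S.key u : ℝ) := by
    refine div_nonneg ?_ (Nat.cast_nonneg _)
    split_ifs
    · exact pStar_nonneg _
    · exact le_rfl
  linarith

theorem sum_leftover : ∑ u ∈ U, S.leftover u = ∑ u ∈ U, S.rate u - pStar S.total := by
  simp only [leftover]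
  rw [Finset.sum_sub_distrib, sum_ite_div_mult S.top_mem]

/-- Taking a function of the branch against the leftover rates. -/
theorem sum_leftover_mul (F : X → ℝ) :
    ∑ u ∈ U, S.leftover u * F (S.key u)
      = ∑ u ∈ U, S.rate u * F (S.key u) - pStar S.total * F (S.key S.top) := by
  simp only [leftover, sub_mul]
  rw [Finset.sum_sub_distrib, ← sum_ite_div_mult (x := S.key) S.top_mem
    (pStar S.total * F (S.key S.top))]
  congr 1
  refine Finset.sum_congr rfl fun u _ => ?_
  split_ifs with h
  · rw [h]; ring
  · simp

theorem sum_size_mul_leftover :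
    ∑ u ∈ U, S.size u * S.leftover u
      = ∑ u ∈ U, S.size u * S.rate u - S.size S.top * pStar S.total := by
  simp only [leftover, mul_sub]
  rw [Finset.sum_sub_distrib, ← sum_ite_div_mult (x := S.key) S.top_mem
    (S.size S.top * pStar S.total)]
  congr 1
  refine Finset.sum_congr rfl fun u hu => ?_
  split_ifs with h
  · rw [S.size_congr u hu _ S.top_mem h]; ring
  · simp

theorem size_mul_rate_le {u : ι} (hu : u ∈ U) : S.size u * S.rate u ≤ 1 :=
  (mul_le_mul_of_nonneg_left (S.rate_le hu) (Nat.cast_nonneg _)).trans (mul_pStar_le_one _)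

theorem sub_one_mul_rate_le {u : ι} (hu : u ∈ U) : ((S.size u : ℝ) - 1) * S.rate u ≤ 1 / 3 := by
  have : (1 : ℝ) ≤ S.size u := by exact_mod_cast S.one_le_size hu
  exact (mul_le_mul_of_nonneg_left (S.rate_le hu) (by linarith)).trans (sub_one_mul_pStar_le _)

theorem total_le : (S.total : ℝ) ≤ 1 + U.card * S.size S.top := by
  rw [S.total_eq, ← nsmul_eq_mul, ← Finset.sum_const]
  gcongr with u hu
  exact (div_le_self (Nat.cast_nonneg _) (one_le_mult hu)).trans
    (by exact_mod_cast S.size_le_top u hu)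

/-- The part of the cost of a color that one of the two colorings contributes. -/
def cost : ℝ :=
  pStar S.total * (S.total - S.size S.top - 1) + ∑ u ∈ U, S.size u * S.leftover u

theorem cost_eq : S.cost = pStar S.total * (S.total - 2 * S.size S.top - 1)
    + ∑ u ∈ U, S.size u * S.rate u := by
  rw [cost, sum_size_mul_leftover]; ring

theorem total_sub_mul_le : pStar S.total * (S.total - 2 * S.size S.top) ≤ 94 / 462 := by
  have : (1 : ℝ) ≤ S.size S.top := by exact_mod_cast S.one_le_size S.top_mem
  refine le_trans ?_ (sub_two_mul_pStar_le S.total)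
  rw [mul_comm]
  exact mul_le_mul_of_nonneg_right (by linarith) (pStar_nonneg _)

theorem cost_le_of_card_eq_two (h : U.card = 2) :
    S.cost ≤ ∑ u ∈ U, S.size u * S.rate u := by
  have := S.total_le
  rw [h] at this
  push_cast at this
  rw [cost_eq]
  have := mul_nonneg (pStar_nonneg S.total)
    (by linarith : (0 : ℝ) ≤ -(S.total - 2 * S.size S.top - 1))
  linarith

theorem cost_le_two (h : U.card = 2) : S.cost ≤ 2 := by
  refine (S.cost_le_of_card_eq_two h).trans ?_
  refine (Finset.sum_le_sum fun u hu => S.size_mul_rate_le hu).trans ?_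
  simp [h]

end Branches

section Cost

open Branches

variable {ι X Y : Type*} [DecidableEq X] [DecidableEq Y]

/-- Crude bounds suffice here: `1 + 1/3` per neighbor and `94/462` for each of the two whole
components. The bound to be met grows faster than `4/3` per neighbor, so three neighbors are the
tightest case. -/
theorem cost_le_of_three_le_card {U : Finset ι} (S : Branches X U) (T : Branches Y U)
    (h : 3 ≤ U.card) :
    S.cost + T.cost - ∑ u ∈ U, min (S.leftover u) (T.leftover u)
      ≤ 11 / 6 * U.card - 1 - 1 / 264 * U.card := by
  have h₀ : ∀ u ∈ U, S.size u * S.rate u + T.size u * T.rate u - min (S.rate u) (T.rate u)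
      ≤ 4 / 3 := by
    intro u hu
    have := S.size_mul_rate_le hu
    have := T.size_mul_rate_le hu
    have := S.sub_one_mul_rate_le hu
    have := T.sub_one_mul_rate_le hu
    rcases min_cases (S.rate u) (T.rate u) with ⟨e, _⟩ | ⟨e, _⟩ <;> rw [e] <;> linarith
  -- Replacing rates by leftovers lowers the sum of the minima by at most the two rates of the whole
  -- components. The `-1` in the first term of `cost_eq` makes up for exactly this.
  have h₁ : ∀ u ∈ U, min (S.rate u) (T.rate u) - (S.rate u - S.leftover u)
      - (T.rate u - T.leftover u) ≤ min (S.leftover u) (T.leftover u) := by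
    intro u hu
    have := S.leftover_le (u := u)
    have := T.leftover_le (u := u)
    have := min_le_left (S.rate u) (T.rate u)
    have := min_le_right (S.rate u) (T.rate u)
    exact le_min (by linarith) (by linarith)
  have h₂ := Finset.sum_le_sum h₀
  have h₃ := Finset.sum_le_sum h₁
  simp only [Finset.sum_sub_distrib, Finset.sum_add_distrib, Finset.sum_const, nsmul_eq_mul]
    at h₂ h₃
  rw [sum_leftover, sum_leftover] at h₃
  rw [S.cost_eq, T.cost_eq]
  have h₅ := S.total_sub_mul_le
  have h₆ := T.total_sub_mul_le
  have h₇ : (3 : ℝ) ≤ U.card := by exact_mod_cast h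
  nlinarith

theorem mult_singleton (x : ι → X) (u : ι) : mult {u} x u = 1 := by
  rw [mult, Finset.filter_singleton, if_pos rfl, Finset.card_singleton]

theorem mult_pair [DecidableEq ι] {x : ι → X} {u w : ι} (h : x u ≠ x w) :
    mult {u, w} x u = 1 ∧ mult {u, w} x w = 1 := by
  constructor
  · rw [mult, Finset.filter_insert, if_pos rfl, Finset.filter_singleton, if_neg h.symm]; simp
  · rw [mult, Finset.filter_insert, if_neg h, Finset.filter_singleton, if_pos rfl]; simp

theorem cost_le_of_card_eq_one {U : Finset ι} (S : Branches X U) (T : Branches Y U)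
    (h : U.card = 1) :
    S.cost + T.cost - ∑ u ∈ U, min (S.leftover u) (T.leftover u)
      ≤ 11 / 6 * U.card - 1
        - 1 / 264 * (U.filter fun u => IsSlack (S.size u) (T.size u)).card := by
  obtain ⟨u, rfl⟩ := Finset.card_eq_one.1 h
  have hu : u ∈ ({u} : Finset ι) := Finset.mem_singleton_self u
  have hS := Finset.mem_singleton.1 S.top_mem
  have hT := Finset.mem_singleton.1 T.top_mem
  have eS := S.total_eq
  have eT := T.total_eq
  simp only [Finset.sum_singleton, mult_singleton, Nat.cast_one, div_one] at eS eT
  have eS' : S.total = 1 + S.size u := by exact_mod_cast eS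
  have eT' : T.total = 1 + T.size u := by exact_mod_cast eT
  have key := cost_one (S.one_le_size hu) (T.one_le_size hu)
  simp only [cost, leftover, rate, Finset.sum_singleton, mult_singleton, hS, hT, if_true,
    Nat.cast_one, div_one, eS', eT', Finset.card_singleton]
  have hc : ((({u} : Finset ι).filter fun u => IsSlack (S.size u) (T.size u)).card : ℝ)
      = if IsSlack (S.size u) (T.size u) then 1 else 0 := by
    rw [Finset.filter_singleton]; split_ifs <;> simp
  rw [hc]
  push_cast
  split_ifs at key ⊢ <;> linarith

/-- The two neighbors share one component of size at least `2`, so this side costs at most `185/308`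
by `mul_pStar_le`. With at most `2` from the other side, nothing has to be saved by pairing. -/
theorem cost_le_of_key_eq [DecidableEq ι] {U : Finset ι} (S : Branches X U) (T : Branches Y U)
    (h : U.card = 2) (hS : ∃ u w, U = {u, w} ∧ u ≠ w ∧ S.key u = S.key w) :
    S.cost + T.cost ≤ 8 / 3 - 2 / 264 := by
  obtain ⟨u, w, rfl, huw, hk⟩ := hS
  have hu : u ∈ ({u, w} : Finset ι) := by simp
  have hw : w ∈ ({u, w} : Finset ι) := by simp
  have m₁ : mult {u, w} S.key u = 2 := by
    rw [mult, Finset.filter_true_of_mem, Finset.card_pair huw]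
    intro z hz
    rcases Finset.mem_insert.1 hz with rfl | hz
    · rfl
    · rw [Finset.mem_singleton.1 hz, hk]
  have m₂ : mult {u, w} S.key w = 2 := by rw [mult, ← hk, ← mult, m₁]
  have h₁ := S.cost_le_of_card_eq_two h
  rw [Finset.sum_pair huw, rate, rate, m₁, m₂, S.size_congr w hw u hu hk.symm] at h₁
  have h₂ := T.cost_le_two h
  have h₃ : 2 ≤ S.size u := m₁ ▸ S.mult_le u hu
  have h₄ := mul_pStar_le h₃
  push_cast at h₁
  linarith

theorem cost_le_of_card_eq_two [DecidableEq ι] {U : Finset ι} (S : Branches X U)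
    (T : Branches Y U) {u w : ι} (hU : U = {u, w}) (huw : u ≠ w)
    (hS : S.key u ≠ S.key w) (hT : T.key u ≠ T.key w) (htop : S.top = u) :
    S.cost + T.cost - ∑ u ∈ U, min (S.leftover u) (T.leftover u)
      ≤ 8 / 3 - (if IsSlack (S.size u) (T.size u) ∨ IsSlack (S.size w) (T.size w)
          then 2 / 264 else 0) := by
  subst hU
  have hu : u ∈ ({u, w} : Finset ι) := by simp
  have hw : w ∈ ({u, w} : Finset ι) := by simp
  obtain ⟨mS, mS'⟩ := mult_pair hS
  obtain ⟨mT, mT'⟩ := mult_pair hT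
  have eS := S.total_eq
  have eT := T.total_eq
  simp only [Finset.sum_pair huw, mS, mS', mT, mT', Nat.cast_one, div_one] at eS eT
  have eS' : S.total = 1 + S.size u + S.size w := by
    have : (S.total : ℝ) = ((1 + S.size u + S.size w : ℕ) : ℝ) := by push_cast; linarith
    exact_mod_cast this
  have eT' : T.total = 1 + T.size u + T.size w := by
    have : (T.total : ℝ) = ((1 + T.size u + T.size w : ℕ) : ℝ) := by push_cast; linarith
    exact_mod_cast this
  have hSw := S.size_le_top w hw
  rw [htop] at hSw
  have key := cost_two_aux (S.one_le_size hu) (S.one_le_size hw) (T.one_le_size hu)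
    (T.one_le_size hw) hSw
  rcases Finset.mem_insert.1 T.top_mem with tT | tT
  · have hTw := T.size_le_top w hw
    rw [tT] at hTw
    have := key.1 hTw
    simp only [cost, leftover, rate, Finset.sum_pair huw, mS, mS', mT, mT', htop, tT, if_true,
      if_neg hS.symm, if_neg hT.symm, Nat.cast_one, div_one, eS', eT', sub_zero]
    push_cast
    linarith
  · have tT := Finset.mem_singleton.1 tT
    have hTw := T.size_le_top u hu
    rw [tT] at hTw
    have := key.2 hTw
    simp only [cost, leftover, rate, Finset.sum_pair huw, mS, mS', mT, mT', htop, tT, if_true,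
      if_neg hS.symm, if_neg hT, Nat.cast_one, div_one, eS', eT', sub_zero]
    push_cast
    linarith

/-- The cost of a color is at most `11/6` per neighbor of that color, less one; every neighbor that
is not in an extremal configuration saves `1/264`. -/
theorem cost_le {U : Finset ι} (S : Branches X U) (T : Branches Y U) :
    S.cost + T.cost - ∑ u ∈ U, min (S.leftover u) (T.leftover u)
      ≤ 11 / 6 * U.card - 1
        - 1 / 264 * (U.filter fun u => IsSlack (S.size u) (T.size u)).card := by
  classical
  have hc : ((U.filter fun u => IsSlack (S.size u) (T.size u)).card : ℝ) ≤ U.card := by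
    exact_mod_cast Finset.card_filter_le _ _
  have h₀ : 0 < U.card := Finset.card_pos.2 ⟨_, S.top_mem⟩
  rcases (by omega : U.card = 1 ∨ U.card = 2 ∨ 3 ≤ U.card) with h | h | h
  · exact cost_le_of_card_eq_one S T h
  · have hmin : 0 ≤ ∑ u ∈ U, min (S.leftover u) (T.leftover u) :=
      Finset.sum_nonneg fun u hu => le_min (S.leftover_nonneg hu) (T.leftover_nonneg hu)
    obtain ⟨u, w, huw, hU⟩ := Finset.card_eq_two.1 h
    by_cases hS : S.key u = S.key w
    · have := cost_le_of_key_eq S T h ⟨u, w, hU, huw, hS⟩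
      rw [h] at hc ⊢
      push_cast at hc ⊢
      linarith
    by_cases hT : T.key u = T.key w
    · have := cost_le_of_key_eq T S h ⟨u, w, hU, huw, hT⟩
      rw [h] at hc ⊢
      push_cast at hc ⊢
      linarith
    -- The saving `2/264` is available as soon as one of the two neighbors is slack, and it pays for
    -- both.
    have fin : ∀ P : Prop, ∀ [Decidable P], (∀ u ∈ U, IsSlack (S.size u) (T.size u) → P) →
        S.cost + T.cost - ∑ u ∈ U, min (S.leftover u) (T.leftover u)
          ≤ 8 / 3 - (if P then 2 / 264 else 0) →
        S.cost + T.cost - ∑ u ∈ U, min (S.leftover u) (T.leftover u) ≤ 11 / 6 * U.card - 1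
          - 1 / 264 * (U.filter fun u => IsSlack (S.size u) (T.size u)).card := by
      intro P _ hP hle
      by_cases hp : P
      · rw [if_pos hp] at hle
        rw [h] at hc ⊢
        push_cast at hc ⊢
        linarith
      · rw [if_neg hp] at hle
        have : U.filter (fun u => IsSlack (S.size u) (T.size u)) = ∅ :=
          Finset.filter_eq_empty_iff.2 fun u hu hs => hp (hP u hu hs)
        rw [this, h]
        push_cast [Finset.card_empty]
        linarith
    have ht : S.top = u ∨ S.top = w := by simpa [hU] using S.top_mem
    rcases ht with ht | ht
    · refine fin _ ?_ (cost_le_of_card_eq_two S T hU huw hS hT ht)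
      intro z hz
      rcases Finset.mem_insert.1 (hU ▸ hz) with rfl | hz
      · exact Or.inl
      · rw [Finset.mem_singleton.1 hz]; exact Or.inr
    · refine fin _ ?_ (cost_le_of_card_eq_two S T (hU.trans (Finset.pair_comm u w)) huw.symm
        (Ne.symm hS) (Ne.symm hT) ht)
      intro z hz
      rcases Finset.mem_insert.1 (hU ▸ hz) with rfl | hz
      · exact Or.inr
      · rw [Finset.mem_singleton.1 hz]; exact Or.inl
  · have := cost_le_of_three_le_card S T h
    linarith

end Cost

section Dynamics

open Classical
set_option linter.unusedSectionVars false

/-! ### Kempe components and flips -/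

variable {V : Type u} [Fintype V] {k : ℕ} {G : SimpleGraph V}

theorem reachable_induction {H : SimpleGraph V} {u w : V} {P : V → Prop} (h₀ : P u)
    (hs : ∀ a b, H.Adj a b → P a → P b) (h : H.Reachable u w) : P w := by
  obtain ⟨p⟩ := h
  induction p with
  | nil => exact h₀
  | cons hadj _ ih => exact ih (hs _ _ hadj h₀)

theorem kempeGraph_comm (G : SimpleGraph V) (σ : Coloring V k) (x y : Fin k) :
    kempeGraph G σ x y = kempeGraph G σ y x := by
  ext a b
  simp only [kempeGraph, or_comm]

theorem mem_kempeComponent {σ : Coloring V k} {u w : V} {c : Fin k} :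
    w ∈ kempeComponent G σ u c ↔ (kempeGraph G σ (σ u) c).Reachable u w := by
  simp [kempeComponent]

theorem self_mem_kempeComponent (σ : Coloring V k) (u : V) (c : Fin k) :
    u ∈ kempeComponent G σ u c :=
  mem_kempeComponent.2 (SimpleGraph.Reachable.refl u)

theorem color_of_mem_kempeComponent {σ : Coloring V k} {u w : V} {c : Fin k}
    (h : w ∈ kempeComponent G σ u c) : σ w = σ u ∨ σ w = c :=
  reachable_induction (H := kempeGraph G σ (σ u) c) (P := fun w => σ w = σ u ∨ σ w = c)
    (Or.inl rfl) (fun _ _ hab _ => hab.2.elim (fun h => Or.inr h.2) (fun h => Or.inl h.2))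
    (mem_kempeComponent.1 h)

theorem mem_kempeComponent_of_adj {σ : Coloring V k} {u a b : V} {c : Fin k}
    (h : a ∈ kempeComponent G σ u c) (hab : (kempeGraph G σ (σ u) c).Adj a b) :
    b ∈ kempeComponent G σ u c :=
  mem_kempeComponent.2 ((mem_kempeComponent.1 h).trans hab.reachable)

theorem kempeComponent_subset {σ : Coloring V k} {u : V} {c : Fin k} {X : Finset V} (h₀ : u ∈ X)
    (hs : ∀ a b, (kempeGraph G σ (σ u) c).Adj a b → a ∈ X → b ∈ X) :
    kempeComponent G σ u c ⊆ X := fun _ hw =>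
  reachable_induction (P := fun w => w ∈ X) h₀ hs (mem_kempeComponent.1 hw)

theorem kempeComponent_eq_of_reachable {σ : Coloring V k} {u w : V} {c d : Fin k}
    (hg : kempeGraph G σ (σ w) d = kempeGraph G σ (σ u) c) (h : w ∈ kempeComponent G σ u c) :
    kempeComponent G σ w d = kempeComponent G σ u c := by
  ext z
  rw [mem_kempeComponent, mem_kempeComponent, hg]
  have h := mem_kempeComponent.1 h
  exact ⟨fun h' => h.trans h', fun h' => h.symm.trans h'⟩

theorem flip_of_notMem {σ : Coloring V k} {u w : V} {c : Fin k}
    (h : w ∉ kempeComponent G σ u c) : flip G σ u c w = σ w := by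
  rw [flip, if_neg h]

theorem flip_of_color_eq {σ : Coloring V k} {u w : V} {c : Fin k}
    (h : w ∈ kempeComponent G σ u c) (hw : σ w = σ u) : flip G σ u c w = c := by
  rw [flip, if_pos h, if_pos hw]

theorem flip_of_color_ne {σ : Coloring V k} {u w : V} {c : Fin k}
    (h : w ∈ kempeComponent G σ u c) (hw : σ w ≠ σ u) : flip G σ u c w = σ u := by
  rw [flip, if_pos h, if_neg hw]

theorem flip_apply_self (σ : Coloring V k) (u : V) (c : Fin k) : flip G σ u c u = c :=
  flip_of_color_eq (self_mem_kempeComponent σ u c) rfl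

theorem flip_self (σ : Coloring V k) (u : V) : flip G σ u (σ u) = σ := by
  funext w
  by_cases h : w ∈ kempeComponent G σ u (σ u)
  · have hw : σ w = σ u := (color_of_mem_kempeComponent h).elim id id
    rw [flip_of_color_eq h hw, hw]
  · exact flip_of_notMem h

theorem flip_apply_ne_iff {σ : Coloring V k} {u w : V} {c : Fin k} (hc : c ≠ σ u) :
    flip G σ u c w ≠ σ w ↔ w ∈ kempeComponent G σ u c := by
  constructor
  · intro h
    by_contra hw
    exact h (flip_of_notMem hw)
  · intro h
    by_cases hw : σ w = σ u
    · rw [flip_of_color_eq h hw, hw]; exact hc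
    · rw [flip_of_color_ne h hw]; exact Ne.symm hw

theorem flip_ne {σ : Coloring V k} {u : V} {c : Fin k} (hc : c ≠ σ u) : flip G σ u c ≠ σ :=
  fun h => (flip_apply_ne_iff hc).2 (self_mem_kempeComponent σ u c) (congrFun h u)

theorem flip_ne_iff {σ : Coloring V k} {u : V} {c : Fin k} : flip G σ u c ≠ σ ↔ c ≠ σ u := by
  refine ⟨?_, flip_ne⟩
  rintro h rfl
  exact h (flip_self σ u)

theorem hammingDist_flip {σ : Coloring V k} {u : V} {c : Fin k} (hc : c ≠ σ u) :
    hammingDist σ (flip G σ u c) = (kempeComponent G σ u c).card := by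
  rw [hammingDist]
  congr 1
  ext w
  rw [Finset.mem_filter, ← flip_apply_ne_iff hc, ne_comm]
  simp

/-- The Kempe component of any vertex of `S_σ(u, c)`, for the same pair of colors. -/
theorem kempeComponent_flip_apply {σ : Coloring V k} {u w : V} {c : Fin k}
    (h : w ∈ kempeComponent G σ u c) :
    kempeComponent G σ w (flip G σ u c w) = kempeComponent G σ u c := by
  refine kempeComponent_eq_of_reachable ?_ h
  by_cases hw : σ w = σ u
  · rw [flip_of_color_eq h hw, hw]
  · rw [flip_of_color_ne h hw, (color_of_mem_kempeComponent h).resolve_left hw, kempeGraph_comm]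

/-- Both flips swap the same two colors on the same set. Hence a move is determined by any vertex
that it recolors and the new color there. -/
theorem flip_flip_apply {σ : Coloring V k} {u w : V} {c : Fin k}
    (h : w ∈ kempeComponent G σ u c) :
    flip G σ w (flip G σ u c w) = flip G σ u c := by
  funext z
  by_cases hz : z ∈ kempeComponent G σ u c
  · have hz' := hz
    rw [← kempeComponent_flip_apply h] at hz'
    have hzc := color_of_mem_kempeComponent hz
    have hwc := color_of_mem_kempeComponent h
    by_cases e : σ z = σ w
    · rw [flip_of_color_eq hz' e]
      by_cases hw : σ w = σ u
      · rw [flip_of_color_eq h hw, flip_of_color_eq hz (e.trans hw)]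
      · rw [flip_of_color_ne h hw, flip_of_color_ne hz (e ▸ hw)]
    · rw [flip_of_color_ne hz' e]
      by_cases hw : σ w = σ u
      · rw [flip_of_color_ne hz (hw ▸ e), hw]
      · have hw' := hwc.resolve_left hw
        have : σ z = σ u := hzc.resolve_right (hw' ▸ e)
        rw [flip_of_color_eq hz this, hw']
  · have hz' := hz
    rw [← kempeComponent_flip_apply h] at hz'
    rw [flip_of_notMem hz, flip_of_notMem hz']

/-- The colorings, other than `σ`, to which flip dynamics can move from `σ`. -/
def moves (G : SimpleGraph V) (σ : Coloring V k) : Finset (Coloring V k) :=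
  Finset.univ.filter fun ρ => ρ ≠ σ ∧ ∃ u c, flip G σ u c = ρ

theorem mem_moves {σ ρ : Coloring V k} :
    ρ ∈ moves G σ ↔ ∃ u c, c ≠ σ u ∧ flip G σ u c = ρ := by
  simp only [moves, Finset.mem_filter, Finset.mem_univ, true_and]
  constructor
  · rintro ⟨h, u, c, rfl⟩
    exact ⟨u, c, flip_ne_iff.1 h, rfl⟩
  · rintro ⟨u, c, hc, rfl⟩
    exact ⟨flip_ne hc, u, c, rfl⟩

theorem flip_mem_moves {σ : Coloring V k} {u : V} {c : Fin k} (hc : c ≠ σ u) :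
    flip G σ u c ∈ moves G σ :=
  mem_moves.2 ⟨u, c, hc, rfl⟩

/-- A move is the flip of the component of any vertex that it recolors. -/
theorem eq_flip_of_mem_moves {σ ρ : Coloring V k} (h : ρ ∈ moves G σ) {w : V} (hw : ρ w ≠ σ w) :
    flip G σ w (ρ w) = ρ := by
  obtain ⟨u, c, hc, rfl⟩ := mem_moves.1 h
  exact flip_flip_apply ((flip_apply_ne_iff hc).1 hw)

theorem kempeComponent_eq_of_mem_moves {σ ρ : Coloring V k} (h : ρ ∈ moves G σ) {w : V}
    (hw : ρ w ≠ σ w) :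
    kempeComponent G σ w (ρ w) = Finset.univ.filter fun z => ρ z ≠ σ z := by
  ext z
  rw [← flip_apply_ne_iff hw, eq_flip_of_mem_moves h hw]
  simp

/-! ### Components away from a vertex -/

/-- The graph without the edges at `v`. -/
def awayFrom (G : SimpleGraph V) (v : V) : SimpleGraph V where
  Adj a b := G.Adj a b ∧ a ≠ v ∧ b ≠ v
  symm := ⟨fun _ _ h => ⟨h.1.symm, h.2.2, h.2.1⟩⟩
  loopless := ⟨fun a h => G.loopless.irrefl a h.1⟩

/-- The vertices joined to `u` by a path avoiding `v` along which the colors `x` and `y`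
alternate. -/
def branch (G : SimpleGraph V) (σ : Coloring V k) (v : V) (x y : Fin k) (u : V) : Finset V :=
  Finset.univ.filter fun w => (kempeGraph (awayFrom G v) σ x y).Reachable u w

theorem mem_branch {σ : Coloring V k} {u v w : V} {x y : Fin k} :
    w ∈ branch G σ v x y u ↔ (kempeGraph (awayFrom G v) σ x y).Reachable u w := by
  simp [branch]

/-- Branches never look at the color of `v`. This is how components of the two colorings are
compared. -/
theorem branch_congr {σ τ : Coloring V k} {v : V} (h : ∀ w, w ≠ v → σ w = τ w) (x y : Fin k)
    (u : V) : branch G σ v x y u = branch G τ v x y u := by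
  have : kempeGraph (awayFrom G v) σ x y = kempeGraph (awayFrom G v) τ x y := by
    ext a b
    simp only [kempeGraph, awayFrom]
    constructor
    · rintro ⟨hab, hc⟩
      rw [h a hab.2.1, h b hab.2.2] at hc
      exact ⟨hab, hc⟩
    · rintro ⟨hab, hc⟩
      rw [← h a hab.2.1, ← h b hab.2.2] at hc
      exact ⟨hab, hc⟩
  rw [branch, this]; rfl

theorem notMem_branch {σ : Coloring V k} {u v : V} {x y : Fin k} (h : u ≠ v) :
    v ∉ branch G σ v x y u := fun hv =>
  reachable_induction (H := kempeGraph (awayFrom G v) σ x y) (P := fun w => w ≠ v) h (fun _ _ hab _ => hab.1.2.2)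
    (mem_branch.1 hv) rfl

theorem kempeGraph_awayFrom_le (σ : Coloring V k) (v : V) (x y : Fin k) :
    kempeGraph (awayFrom G v) σ x y ≤ kempeGraph G σ x y := fun _ _ h => ⟨h.1.1, h.2⟩

theorem branch_subset (σ : Coloring V k) (u v : V) (c : Fin k) :
    branch G σ v (σ u) c u ⊆ kempeComponent G σ u c := fun _ hw =>
  mem_kempeComponent.2 ((mem_branch.1 hw).mono (kempeGraph_awayFrom_le _ _ _ _))

theorem kempeComponent_eq_branch {σ : Coloring V k} {u v : V} {c : Fin k}
    (h : v ∉ kempeComponent G σ u c) : kempeComponent G σ u c = branch G σ v (σ u) c u := by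
  refine Finset.Subset.antisymm ?_ (branch_subset σ u v c)
  intro w hw
  refine (reachable_induction (P := fun w => w ∈ branch G σ v (σ u) c u) ?_ ?_
    (mem_kempeComponent.1 hw))
  · exact mem_branch.2 (SimpleGraph.Reachable.refl u)
  · intro a b hab ha
    have hav : a ≠ v := by
      rintro rfl; exact h (branch_subset _ _ _ _ ha)
    have hbv : b ≠ v := by
      rintro rfl
      exact h (mem_kempeComponent_of_adj (branch_subset _ _ _ _ ha) hab)
    exact mem_branch.2 ((mem_branch.1 ha).trans
      (SimpleGraph.Adj.reachable ⟨⟨hab.1, hav, hbv⟩, hab.2⟩))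

/-- If a Kempe component reaches `v`, it does so through a neighbor of `v` in the branch. -/
theorem exists_mem_branch_adj {σ : Coloring V k} {u v : V} {c : Fin k} (huv : u ≠ v)
    (h : v ∈ kempeComponent G σ u c) :
    ∃ w ∈ branch G σ v (σ u) c u, (kempeGraph G σ (σ u) c).Adj w v := by
  by_contra! hcon
  have := kempeComponent_subset (G := G) (σ := σ) (u := u) (c := c)
    (X := branch G σ v (σ u) c u) (mem_branch.2 (SimpleGraph.Reachable.refl u)) (by
      intro a b hab ha
      have hav : a ≠ v := by
        rintro rfl; exact notMem_branch huv ha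
      have hbv : b ≠ v := by
        rintro rfl
        exact hcon a ha hab
      exact mem_branch.2 ((mem_branch.1 ha).trans
        (SimpleGraph.Adj.reachable ⟨⟨hab.1, hav, hbv⟩, hab.2⟩)))
  exact notMem_branch huv (this h)

/-- The neighbors of `v` of color `c`. -/
def nbrs (G : SimpleGraph V) (σ : Coloring V k) (v : V) (c : Fin k) : Finset V :=
  Finset.univ.filter fun u => G.Adj v u ∧ σ u = c

theorem mem_nbrs {σ : Coloring V k} {v u : V} {c : Fin k} :
    u ∈ nbrs G σ v c ↔ G.Adj v u ∧ σ u = c := by simp [nbrs]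

/-- Removing `v` leaves the branches at its neighbors of color `c`; as `c ≠ σ v`, alternating edges
at `v` lead only to that color. -/
theorem kempeComponent_eq_insert {σ : Coloring V k} {v : V} {c : Fin k} (hc : c ≠ σ v) :
    kempeComponent G σ v c
      = insert v ((nbrs G σ v c).biUnion (branch G σ v c (σ v))) := by
  refine Finset.Subset.antisymm (kempeComponent_subset (Finset.mem_insert_self _ _) ?_) ?_
  · intro a b hab ha
    by_cases hbv : b = v
    · rw [hbv]; exact Finset.mem_insert_self _ _
    refine Finset.mem_insert_of_mem (Finset.mem_biUnion.2 ?_)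
    by_cases hav : a = v
    · subst hav
      have hb : σ b = c := by
        rcases hab.2 with h | h
        · exact h.2
        · exact absurd h.1.symm hc
      exact ⟨b, mem_nbrs.2 ⟨hab.1, hb⟩, mem_branch.2 (SimpleGraph.Reachable.refl b)⟩
    · obtain ⟨w, hw, haw⟩ := Finset.mem_biUnion.1 (Finset.mem_of_mem_insert_of_ne ha hav)
      refine ⟨w, hw, mem_branch.2 ((mem_branch.1 haw).trans
        (SimpleGraph.Adj.reachable ⟨⟨hab.1, hav, hbv⟩, hab.2.symm⟩))⟩
  · intro w hw
    rcases Finset.mem_insert.1 hw with rfl | hw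
    · exact self_mem_kempeComponent _ _ _
    · obtain ⟨u, hu, huw⟩ := Finset.mem_biUnion.1 hw
      obtain ⟨hvu, huc⟩ := mem_nbrs.1 hu
      refine mem_kempeComponent.2 (SimpleGraph.Reachable.trans (v := u)
        (SimpleGraph.Adj.reachable ⟨hvu, Or.inl ⟨rfl, huc⟩⟩) ?_)
      rw [kempeGraph_comm]
      exact (mem_branch.1 huw).mono (kempeGraph_awayFrom_le _ _ _ _)

/-! ### The generator of flip dynamics -/

/-- The generator of flip dynamics, with rates scaled by the number of vertices times the number of
colors. -/
def gen (G : SimpleGraph V) (f : Coloring V k → ℝ) (σ : Coloring V k) : ℝ :=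
  ∑ ρ ∈ moves G σ, pStar (hammingDist σ ρ) * (f ρ - f σ)

/-- A move `ρ` that recolors `l` vertices is proposed by exactly `l` pairs, namely `(w, ρ w)` for
the recolored `w`, each with probability factor `p_l / l`. Its rate is thus `p_l`. The pairs with `c
= σ u` change nothing and drop out by `F σ = 0`. -/
theorem sum_flips (σ : Coloring V k) {F : Coloring V k → ℝ} (hF : F σ = 0) :
    ∑ u : V, ∑ c : Fin k, pStar (kempeComponent G σ u c).card
        / ((kempeComponent G σ u c).card : ℝ) * F (flip G σ u c)
      = ∑ ρ ∈ moves G σ, pStar (hammingDist σ ρ) * F ρ := by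
  rw [← Finset.sum_product']
  rw [← Finset.sum_filter_of_ne (p := fun x : V × Fin k => x.2 ≠ σ x.1)]
  swap
  · rintro ⟨u, c⟩ _ h hc
    obtain rfl : c = σ u := hc
    exact h (by simp only [flip_self, hF, mul_zero])
  rw [← Finset.sum_fiberwise_of_maps_to (t := moves G σ) (g := fun x : V × Fin k => flip G σ x.1 x.2)
    (fun x hx => flip_mem_moves (Finset.mem_filter.1 hx).2)]
  refine Finset.sum_congr rfl fun ρ hρ => ?_
  have hset : ((Finset.univ ×ˢ Finset.univ).filter (fun x : V × Fin k => x.2 ≠ σ x.1)).filter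
      (fun x => flip G σ x.1 x.2 = ρ)
      = (Finset.univ.filter fun w => σ w ≠ ρ w).image fun w => (w, ρ w) := by
    ext ⟨u, c⟩
    simp only [Finset.mem_filter, Finset.mem_image, Finset.mem_product, Finset.mem_univ,
      true_and, Prod.mk.injEq]
    constructor
    · rintro ⟨hc, rfl⟩
      exact ⟨u, by rw [flip_apply_self]; exact hc.symm, rfl, flip_apply_self _ _ _⟩
    · rintro ⟨w, hw, rfl, rfl⟩
      exact ⟨hw.symm, eq_flip_of_mem_moves hρ hw.symm⟩
  rw [hset, Finset.sum_image (fun a _ b _ h => (Prod.mk.inj h).1)]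
  have hterm : ∀ w ∈ Finset.univ.filter (fun w => σ w ≠ ρ w),
      pStar (kempeComponent G σ w (ρ w)).card / ((kempeComponent G σ w (ρ w)).card : ℝ)
        * F (flip G σ w (ρ w)) = pStar (hammingDist σ ρ) / (hammingDist σ ρ : ℝ) * F ρ := by
    intro w hw
    have hw := (Finset.mem_filter.1 hw).2.symm
    rw [← hammingDist_flip hw, eq_flip_of_mem_moves hρ hw]
  rw [Finset.sum_congr rfl hterm, Finset.sum_const, nsmul_eq_mul, ← hammingDist]
  have hne : (hammingDist σ ρ : ℝ) ≠ 0 := by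
    obtain ⟨u, c, hc, rfl⟩ := mem_moves.1 hρ
    exact_mod_cast hammingDist_ne_zero.2 (flip_ne hc).symm
  field_simp

theorem transition_mulVec (hn : Fintype.card V ≠ 0) (hk : k ≠ 0) (f : Coloring V k → ℝ)
    (σ : Coloring V k) :
    (transition G k pStar).mulVec f σ = f σ + gen G f σ / ((Fintype.card V : ℝ) * k) := by
  have hn' : (Fintype.card V : ℝ) ≠ 0 := by exact_mod_cast hn
  have hk' : (k : ℝ) ≠ 0 := by exact_mod_cast hk
  rw [gen, ← sum_flips (F := fun ρ => f ρ - f σ) σ (sub_self _)]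
  simp only [Matrix.mulVec, dotProduct, transition]
  simp only [mul_assoc, Finset.sum_mul, ← Finset.mul_sum]
  rw [Finset.sum_comm]
  have h : ∀ u : V, ∑ ρ : Coloring V k, ∑ c : Fin k,
      (pStar (kempeComponent G σ u c).card / ((kempeComponent G σ u c).card : ℝ) *
        (if ρ = flip G σ u c then 1 else 0) +
      (1 - pStar (kempeComponent G σ u c).card / ((kempeComponent G σ u c).card : ℝ)) *
        (if ρ = σ then 1 else 0)) * f ρ
      = k * f σ + ∑ c : Fin k, pStar (kempeComponent G σ u c).card
        / ((kempeComponent G σ u c).card : ℝ) * (f (flip G σ u c) - f σ) := by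
    intro u
    rw [Finset.sum_comm]
    have : (k : ℝ) * f σ = ∑ c : Fin k, f σ := by simp
    rw [this, ← Finset.sum_add_distrib]
    refine Finset.sum_congr rfl fun c _ => ?_
    simp only [add_mul, Finset.sum_add_distrib, mul_assoc, ite_mul, one_mul, zero_mul,
      ← Finset.mul_sum, Finset.sum_ite_eq', Finset.mem_univ, if_true]
    ring
  rw [Finset.sum_congr rfl fun u _ => h u, Finset.sum_add_distrib, Finset.sum_const,
    Finset.card_univ, nsmul_eq_mul]
  field_simp

/-! ### Proper colorings -/

theorem isProper_flip {σ : Coloring V k} (hσ : IsProper G σ) (u : V) (c : Fin k) :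
    IsProper G (flip G σ u c) := by
  by_cases hc : c = σ u
  · rw [hc, flip_self]; exact hσ
  intro a b hab heq
  wlog ha : a ∈ kempeComponent G σ u c generalizing a b with H
  · by_cases hb : b ∈ kempeComponent G σ u c
    · exact H b a hab.symm heq.symm hb
    · rw [flip_of_notMem ha, flip_of_notMem hb] at heq
      exact hσ a b hab heq
  have hne := hσ a b hab
  have hac := color_of_mem_kempeComponent ha
  by_cases hb : b ∈ kempeComponent G σ u c
  · have hbc := color_of_mem_kempeComponent hb
    by_cases e : σ a = σ u
    · rw [flip_of_color_eq ha e, flip_of_color_ne hb (e ▸ hne.symm)] at heq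
      exact hc heq
    · have hbu : σ b = σ u := hbc.resolve_right (fun h => hne ((hac.resolve_left e).trans h.symm))
      rw [flip_of_color_ne ha e, flip_of_color_eq hb hbu] at heq
      exact hc heq.symm
  · rw [flip_of_notMem hb] at heq
    refine hb (mem_kempeComponent_of_adj ha ⟨hab, ?_⟩)
    by_cases e : σ a = σ u
    · rw [flip_of_color_eq ha e] at heq
      exact Or.inl ⟨e, heq.symm⟩
    · rw [flip_of_color_ne ha e] at heq
      exact Or.inr ⟨hac.resolve_left e, heq.symm⟩

/-- Flipping the same component twice gives back a proper coloring. -/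
theorem flip_flip_of_isProper {σ : Coloring V k} (hσ : IsProper G σ) {u : V} {c : Fin k}
    (hc : c ≠ σ u) : flip G (flip G σ u c) u (σ u) = σ := by
  set ρ := flip G σ u c with hρ
  have hρu : ρ u = c := flip_apply_self σ u c
  have hadj : ∀ a b, a ∈ kempeComponent G σ u c →
      (kempeGraph G ρ c (σ u)).Adj a b → b ∈ kempeComponent G σ u c := by
    intro a b ha hab
    by_contra hb
    have hac := color_of_mem_kempeComponent ha
    have hb' : ρ b = σ b := flip_of_notMem hb
    have hne := hσ a b hab.1
    rcases hab.2 with ⟨h₁, h₂⟩ | ⟨h₁, h₂⟩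
    · have : σ a = σ u := by
        by_contra e
        rw [hρ, flip_of_color_ne ha e] at h₁
        exact hc h₁.symm
      exact hne (this.trans (h₂.symm.trans hb'))
    · have : σ a = c := by
        refine hac.resolve_left fun e => ?_
        rw [hρ, flip_of_color_eq ha e] at h₁
        exact hc h₁
      exact hne (this.trans (h₂.symm.trans hb'))
  have hset : kempeComponent G ρ u (σ u) = kempeComponent G σ u c := by
    refine Finset.Subset.antisymm ?_ ?_
    · refine kempeComponent_subset (self_mem_kempeComponent σ u c) ?_
      rw [hρu]
      exact fun a b hab ha => hadj a b ha hab
    · have h : kempeComponent G σ u c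
          ⊆ kempeComponent G ρ u (σ u) ∩ kempeComponent G σ u c := by
        refine kempeComponent_subset (Finset.mem_inter.2
          ⟨self_mem_kempeComponent _ _ _, self_mem_kempeComponent _ _ _⟩) ?_
        intro a b hab ha
        obtain ⟨ha₁, ha₂⟩ := Finset.mem_inter.1 ha
        have hb₂ := mem_kempeComponent_of_adj ha₂ hab
        refine Finset.mem_inter.2 ⟨mem_kempeComponent_of_adj ha₁ ⟨hab.1, ?_⟩, hb₂⟩
        rw [hρu]
        rcases hab.2 with ⟨h₁, h₂⟩ | ⟨h₁, h₂⟩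
        · exact Or.inl ⟨flip_of_color_eq ha₂ h₁, flip_of_color_ne hb₂ (h₂ ▸ hc)⟩
        · exact Or.inr ⟨flip_of_color_ne ha₂ (h₁ ▸ hc), flip_of_color_eq hb₂ h₂⟩
      exact h.trans Finset.inter_subset_left
  funext w
  by_cases hw : w ∈ kempeComponent G σ u c
  · have hwc := color_of_mem_kempeComponent hw
    by_cases e : σ w = σ u
    · rw [flip_of_color_eq (hset ▸ hw) (by rw [hρu, hρ, flip_of_color_eq hw e]), e]
    · rw [flip_of_color_ne (hset ▸ hw) (by rw [hρu, hρ, flip_of_color_ne hw e]; exact hc.symm),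
        hρu, hwc.resolve_left e]
  · rw [flip_of_notMem (hset ▸ hw), hρ, flip_of_notMem hw]

theorem mem_moves_symm {σ ρ : Coloring V k} (hσ : IsProper G σ) (h : ρ ∈ moves G σ) :
    IsProper G ρ ∧ σ ∈ moves G ρ := by
  obtain ⟨u, c, hc, rfl⟩ := mem_moves.1 h
  refine ⟨isProper_flip hσ u c, mem_moves.2 ⟨u, σ u, ?_, flip_flip_of_isProper hσ hc⟩⟩
  rw [flip_apply_self]
  exact hc.symm

/-- Detailed balance: on proper colorings every move can be undone at the same rate. Improper
colorings have weight `0` and cannot be reached from proper ones. -/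
theorem sum_uniformProper_mul_gen (f : Coloring V k → ℝ) :
    ∑ σ, uniformProper G k σ * gen G f σ = 0 := by
  set w : Coloring V k → Coloring V k → ℝ := fun σ ρ =>
    if ρ ∈ moves G σ then uniformProper G k σ * pStar (hammingDist σ ρ) else 0 with hw
  have hsymm : ∀ σ ρ, w σ ρ = w ρ σ := by
    intro σ ρ
    simp only [hw, hammingDist_comm ρ σ]
    by_cases hσ : IsProper G σ
    · by_cases h : ρ ∈ moves G σ
      · have h' := mem_moves_symm hσ h
        rw [if_pos h, if_pos h'.2, uniformProper, uniformProper, if_pos hσ, if_pos h'.1]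
      · rw [if_neg h]
        split_ifs with h''
        · by_cases hρ : IsProper G ρ
          · exact absurd (mem_moves_symm hρ h'').2 h
          · rw [uniformProper, if_neg hρ, zero_mul]
        · rfl
    · by_cases hρ : IsProper G ρ
      · rw [if_neg (fun h'' => hσ (mem_moves_symm hρ h'').1)]
        split_ifs
        · rw [uniformProper, if_neg hσ, zero_mul]
        · rfl
      · simp only [uniformProper, if_neg hσ, if_neg hρ, zero_mul]
        split_ifs <;> rfl
  have hT : ∑ σ, uniformProper G k σ * gen G f σ = ∑ σ, ∑ ρ, w σ ρ * (f ρ - f σ) := by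
    refine Finset.sum_congr rfl fun σ _ => ?_
    simp only [gen, Finset.mul_sum, hw, ite_mul, zero_mul]
    rw [← Finset.sum_filter]
    simp [mul_assoc]
  have hneg : ∑ σ, ∑ ρ, w σ ρ * (f ρ - f σ) = - ∑ σ, ∑ ρ, w σ ρ * (f ρ - f σ) := by
    conv_lhs => rw [Finset.sum_comm]
    rw [← Finset.sum_neg_distrib]
    refine Finset.sum_congr rfl fun σ _ => ?_
    rw [← Finset.sum_neg_distrib]
    refine Finset.sum_congr rfl fun ρ _ => ?_
    rw [hsymm ρ σ]; ring
  rw [hT]; linarith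

theorem uniformProper_nonneg (σ : Coloring V k) : 0 ≤ uniformProper G k σ := by
  rw [uniformProper]; split_ifs <;> positivity

theorem sum_uniformProper (h : ∃ σ : Coloring V k, IsProper G σ) :
    ∑ σ, uniformProper G k σ = 1 := by
  obtain ⟨σ, hσ⟩ := h
  simp only [uniformProper]
  rw [← Finset.sum_filter, Finset.sum_const, nsmul_eq_mul]
  have : ((Finset.univ.filter fun τ : Coloring V k => IsProper G τ).card : ℝ) ≠ 0 := by
    exact_mod_cast (Finset.card_pos.2 ⟨σ, by simpa using hσ⟩).ne'
  field_simp

/-! ### Mixing from contraction -/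

/-- By stationarity `π(A)` is the `π`-average of `P^t 1_A`, so the distance is at most the
oscillation of `P^t 1_A`. -/
theorem worstDist_le {S : Type u} [Fintype S] [DecidableEq S] {P : Matrix S S ℝ} {π : S → ℝ}
    (hπ : ∀ s, 0 ≤ π s) (hπ₁ : ∑ s, π s = 1)
    (hP : ∀ f : S → ℝ, ∑ s, π s * P.mulVec f s = ∑ s, π s * f s) {t : ℕ} {δ : ℝ}
    (h : ∀ (A : Finset S) (x y : S), (P ^ t).mulVec (fun s => if s ∈ A then 1 else 0) x
      - (P ^ t).mulVec (fun s => if s ∈ A then 1 else 0) y ≤ δ) (hδ : 0 ≤ δ) :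
    worstDist P π t ≤ δ := by
  have hPt : ∀ (t : ℕ) (f : S → ℝ), ∑ s, π s * (P ^ t).mulVec f s = ∑ s, π s * f s := by
    intro t
    induction t with
    | zero => intro f; simp
    | succ t ih => intro f; rw [pow_succ, ← Matrix.mulVec_mulVec, ih, hP]
  refine Real.iSup_le (fun x => Real.iSup_le (fun A => ?_) hδ) hδ
  set g := (P ^ t).mulVec (fun s => if s ∈ A then (1 : ℝ) else 0) with hg
  have h₁ : ∑ s ∈ A, (P ^ t) x s = g x := by
    simp [hg, Matrix.mulVec, dotProduct]
  have h₂ : ∑ s ∈ A, π s = ∑ y, π y * g y := by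
    rw [hg, hPt]; simp
  have h₃ : ∑ s ∈ A, (P ^ t) x s - ∑ s ∈ A, π s = ∑ y, π y * (g x - g y) := by
    simp only [mul_sub, Finset.sum_sub_distrib, ← Finset.sum_mul, hπ₁, h₁, h₂, one_mul]
  rw [h₃]
  refine (Finset.abs_sum_le_sum_abs _ _).trans ?_
  calc ∑ y, |π y * (g x - g y)| ≤ ∑ y, π y * δ := by
        refine Finset.sum_le_sum fun y _ => ?_
        rw [abs_mul, abs_of_nonneg (hπ y)]
        exact mul_le_mul_of_nonneg_left (abs_le.2 ⟨by linarith [h A y x], h A x y⟩) (hπ y)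
    _ = δ := by rw [← Finset.sum_mul, hπ₁, one_mul]

theorem flipMixesWithin_of_worstDist_le {p : ℕ → ℝ} {t : ℕ} {T : ℝ}
    (h : worstDist (transition G k p) (uniformProper G k) t ≤ 1 / 4) (ht : (t : ℝ) ≤ T) :
    FlipMixesWithin G k p T := by
  have hex : ∃ t, worstDist (transition G k p) (uniformProper G k) t ≤ 1 / 4 := ⟨t, h⟩
  refine ⟨Nat.find hex, ⟨Nat.find_spec hex, fun s hs => Nat.find_min' hex hs⟩, le_trans ?_ ht⟩
  exact_mod_cast Nat.find_min' hex h

/-- Recoloring one vertex changes `f` by at most `L` times the weight of the recoloring. -/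
def EdgeLipschitz (d : Coloring V k → V → Fin k → ℝ) (L : ℝ) (f : Coloring V k → ℝ) : Prop :=
  ∀ σ v t, t ≠ σ v → f σ - f (Function.update σ v t) ≤ L * d σ v t

/-- The vertices where `x` and `y` disagree are recolored one at a time, each at a price of at most
`L`. -/
theorem EdgeLipschitz.sub_le {d : Coloring V k → V → Fin k → ℝ} {L : ℝ} {f : Coloring V k → ℝ}
    (hf : EdgeLipschitz d L f) (hL : 0 ≤ L) (hd : ∀ σ v t, d σ v t ≤ 1) (x y : Coloring V k) :
    f x - f y ≤ L * hammingDist x y := by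
  induction hm : hammingDist x y generalizing x with
  | zero => rw [hammingDist_eq_zero.1 hm]; simp
  | succ m ih =>
    have hne : x ≠ y := hammingDist_ne_zero.1 (by omega)
    obtain ⟨v, hv⟩ := Function.ne_iff.1 hne
    have hdist : hammingDist (Function.update x v (y v)) y = m := by
      have : (Finset.univ.filter fun i => x i ≠ y i)
          = insert v (Finset.univ.filter fun i => Function.update x v (y v) i ≠ y i) := by
        ext i
        by_cases hi : i = v
        · subst hi; simp [hv]
        · simp [hi]
      rw [hammingDist, this, Finset.card_insert_of_notMem (by simp)] at hm
      rw [hammingDist]; omega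
    have h₁ := ih _ hdist
    have h₂ := hf x v (y v) hv.symm
    have h₃ := mul_le_mul_of_nonneg_left (hd x v (y v)) hL
    push_cast
    linarith

theorem EdgeLipschitz.smul {d : Coloring V k → V → Fin k → ℝ} {L : ℝ} {f : Coloring V k → ℝ}
    (hf : EdgeLipschitz d L f) {a : ℝ} (ha : 0 ≤ a) : EdgeLipschitz d (a * L) (a • f) := by
  intro σ v t ht
  have := mul_le_mul_of_nonneg_left (hf σ v t ht) ha
  simp only [Pi.smul_apply, smul_eq_mul]
  linarith

/-- Weights at least `1/2` give indicators the constant `2`, and weights at most `1` bound the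
diameter by `n`. It remains to have `2 n (1 - κ)^t ≤ 1/4`, which follows from `κ t ≥ log(8n)`. -/
theorem worstDist_le_of_contraction (hn : Fintype.card V ≠ 0) (hk : k ≠ 0)
    (hproper : ∃ σ : Coloring V k, IsProper G σ) {d : Coloring V k → V → Fin k → ℝ}
    (hd : ∀ σ v t, d σ v t ≤ 1) (hd' : ∀ σ v t, 1 / 2 ≤ d σ v t) {κ : ℝ} (hκ : κ < 1)
    (hstep : ∀ f : Coloring V k → ℝ, EdgeLipschitz d 1 f →
      EdgeLipschitz d (1 - κ) fun σ => f σ + gen G f σ / ((Fintype.card V : ℝ) * k))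
    {t : ℕ} (ht : Real.log (8 * Fintype.card V) ≤ κ * t) [DecidableEq (Coloring V k)] :
    worstDist (transition G k pStar) (uniformProper G k) t ≤ 1 / 4 := by
  have hmul : ∀ f : Coloring V k → ℝ, (transition G k pStar).mulVec f
      = fun σ => f σ + gen G f σ / ((Fintype.card V : ℝ) * k) :=
    fun f => funext fun σ => transition_mulVec hn hk f σ
  have hiter : ∀ (t : ℕ) (f : Coloring V k → ℝ), EdgeLipschitz d 2 f →
      EdgeLipschitz d (2 * (1 - κ) ^ t) ((transition G k pStar ^ t).mulVec f) := by
    intro t f hf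
    induction t with
    | zero => simpa using hf
    | succ t ih =>
      have hpos : 0 < 2 * (1 - κ) ^ t := by
        have : 0 < 1 - κ := by linarith
        positivity
      -- `hstep` is stated for constant `1`, so the function is normalized, moved by one step and
      -- scaled back.
      have h₁ := ih.smul (inv_nonneg.2 hpos.le)
      rw [inv_mul_cancel₀ hpos.ne'] at h₁
      have h₂ := (hstep _ h₁).smul hpos.le
      rw [← hmul, Matrix.mulVec_smul, smul_smul, mul_inv_cancel₀ hpos.ne', one_smul,
        Matrix.mulVec_mulVec, ← pow_succ', mul_assoc, ← pow_succ] at h₂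
      exact h₂
  refine worstDist_le uniformProper_nonneg (sum_uniformProper hproper) ?_ ?_ (by norm_num)
  · intro f
    simp only [transition_mulVec hn hk, mul_add, Finset.sum_add_distrib]
    rw [add_eq_left]
    simp only [← mul_div_assoc, ← Finset.sum_div, sum_uniformProper_mul_gen, zero_div]
  · intro A x y
    have hind : EdgeLipschitz d 2 (fun s => if s ∈ A then (1 : ℝ) else 0) := by
      intro σ v c _
      have := hd' σ v c
      dsimp only
      split_ifs <;> linarith
    have hnn : 0 ≤ 1 - κ := by linarith
    refine ((hiter t _ hind).sub_le (by positivity) hd x y).trans ?_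
    have hcard : (hammingDist x y : ℝ) ≤ Fintype.card V := by
      exact_mod_cast hammingDist_le_card_fintype
    have hnpos : (0 : ℝ) < Fintype.card V := by exact_mod_cast Nat.pos_of_ne_zero hn
    have hexp : (1 - κ) ^ t ≤ 1 / (8 * Fintype.card V) := by
      calc (1 - κ) ^ t ≤ Real.exp (-κ) ^ t :=
            pow_le_pow_left₀ hnn (by linarith [Real.add_one_le_exp (-κ)]) t
        _ = Real.exp (-(κ * t)) := by rw [← Real.exp_nat_mul]; ring_nf
        _ ≤ Real.exp (-Real.log (8 * Fintype.card V)) := Real.exp_le_exp.2 (by linarith)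
        _ = 1 / (8 * Fintype.card V) := by
            rw [Real.exp_neg, Real.exp_log (by positivity), one_div]
    calc 2 * (1 - κ) ^ t * (hammingDist x y : ℝ)
        ≤ 2 * (1 / (8 * Fintype.card V)) * Fintype.card V := by gcongr
      _ = 1 / 4 := by field_simp; norm_num

/-! ### Moves of two colorings that differ at one vertex -/

/-- Two colorings differ exactly at `v`. -/
structure DifferAt (σ τ : Coloring V k) (v : V) : Prop where
  ne : σ v ≠ τ v
  eq_of_ne : ∀ w, w ≠ v → σ w = τ w

theorem DifferAt.symm {σ τ : Coloring V k} {v : V} (h : DifferAt σ τ v) : DifferAt τ σ v :=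
  ⟨h.ne.symm, fun w hw => (h.eq_of_ne w hw).symm⟩

theorem DifferAt.update_eq {σ τ : Coloring V k} {v : V} (h : DifferAt σ τ v) :
    Function.update σ v (τ v) = τ := by
  funext w
  by_cases hw : w = v
  · subst hw; simp
  · rw [Function.update_of_ne hw, h.eq_of_ne w hw]

theorem differAt_update {σ : Coloring V k} {v : V} {t : Fin k} (h : t ≠ σ v) :
    DifferAt σ (Function.update σ v t) v :=
  ⟨by simpa using h.symm, fun w hw => (Function.update_of_ne hw _ _).symm⟩

/-- The neighbors of `v` whose Kempe component in `σ` for the color `τ v` avoids `v`. -/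
def solo (G : SimpleGraph V) (σ τ : Coloring V k) (v : V) : Finset V :=
  Finset.univ.filter fun u => G.Adj v u ∧ σ u ≠ τ v ∧ v ∉ kempeComponent G σ u (τ v)

/-- The moves of `σ` that fix the color of `v` and are also moves of `τ`. -/
def common (G : SimpleGraph V) (σ τ : Coloring V k) (v : V) : Finset (Coloring V k) :=
  (moves G σ).filter fun ρ => ρ v = σ v ∧ Function.update ρ v (τ v) ∈ moves G τ

theorem mem_solo {σ τ : Coloring V k} {v u : V} : u ∈ solo G σ τ v ↔
    G.Adj v u ∧ σ u ≠ τ v ∧ v ∉ kempeComponent G σ u (τ v) := by simp [solo]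

theorem mem_common {σ τ ρ : Coloring V k} {v : V} : ρ ∈ common G σ τ v ↔
    ρ ∈ moves G σ ∧ ρ v = σ v ∧ Function.update ρ v (τ v) ∈ moves G τ := by
  simp [common]

/-- Components that avoid `v` in both colorings agree. -/
theorem DifferAt.flip_eq_update {σ τ : Coloring V k} {v u : V} (h : DifferAt σ τ v) (huv : u ≠ v)
    {c : Fin k} (hσ : v ∉ kempeComponent G σ u c) (hτ : v ∉ kempeComponent G τ u c) :
    flip G τ u c = Function.update (flip G σ u c) v (τ v) := by
  have hset : kempeComponent G τ u c = kempeComponent G σ u c := by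
    rw [kempeComponent_eq_branch hσ, kempeComponent_eq_branch hτ, h.eq_of_ne u huv,
      branch_congr h.eq_of_ne]
  funext w
  by_cases hw : w = v
  · subst hw; rw [Function.update_self, flip_of_notMem hτ]
  · rw [Function.update_of_ne hw, flip, flip, hset, h.eq_of_ne w hw, h.eq_of_ne u huv]

/-- A move of `σ` away from `v` fails to be a move of `τ` only if its component becomes attached to
`v` once `v` has color `τ v`. It is then the flip at a neighbor of `v` towards `τ v`. -/
theorem DifferAt.filter_moves_eq_image {σ τ : Coloring V k} {v : V} (h : DifferAt σ τ v) :
    ((moves G σ).filter fun ρ => ρ v = σ v ∧ Function.update ρ v (τ v) ∉ moves G τ)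
      = (solo G σ τ v).image fun u => flip G σ u (τ v) := by
  ext ρ
  simp only [Finset.mem_filter, Finset.mem_image]
  constructor
  · rintro ⟨hρ, hρv, hτ⟩
    obtain ⟨u, c, hc, rfl⟩ := mem_moves.1 hρ
    have hvS : v ∉ kempeComponent G σ u c := fun hv => (flip_apply_ne_iff hc).2 hv hρv
    have huv : u ≠ v := by
      rintro rfl; exact hvS (self_mem_kempeComponent _ _ _)
    have hvT : v ∈ kempeComponent G τ u c := by
      by_contra hvT
      rw [← h.flip_eq_update huv hvS hvT] at hτ
      exact hτ (flip_mem_moves (h.eq_of_ne u huv ▸ hc))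
    -- The component in `τ` enters `v` through a neighbor `x` of `v`. This `x` already lies in the
    -- component in `σ`, whose flip gives it the color `τ v`; so `x` is the required element of
    -- `solo`.
    obtain ⟨x, hx, hxv⟩ := exists_mem_branch_adj huv hvT
    have hxv' : x ≠ v := hxv.1.ne
    have hxS : x ∈ kempeComponent G σ u c := by
      rw [kempeComponent_eq_branch hvS, branch_congr h.eq_of_ne, h.eq_of_ne u huv]
      exact hx
    have hcol : flip G σ u c x = τ v ∧ σ x ≠ τ v := by
      have hcolor := hxv.2
      rw [← h.eq_of_ne x hxv', ← h.eq_of_ne u huv] at hcolor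
      rcases hcolor with ⟨h₁, h₂⟩ | ⟨h₁, h₂⟩
      · rw [flip_of_color_eq hxS h₁, h₂, h₁]; exact ⟨rfl, hc.symm⟩
      · rw [flip_of_color_ne hxS (h₁ ▸ hc), h₂, h₁]; exact ⟨rfl, hc⟩
    refine ⟨x, mem_solo.2 ⟨hxv.1.symm, hcol.2, ?_⟩, ?_⟩
    · rw [← hcol.1, kempeComponent_flip_apply hxS]; exact hvS
    · rw [← hcol.1, flip_flip_apply hxS]
  · rintro ⟨u, hu, rfl⟩
    obtain ⟨hvu, hut, hv⟩ := mem_solo.1 hu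
    have huv : u ≠ v := hvu.ne'
    refine ⟨flip_mem_moves hut.symm, flip_of_notMem hv, fun hτ => ?_⟩
    have hval : Function.update (flip G σ u (τ v)) v (τ v) u = τ v := by
      rw [Function.update_of_ne huv, flip_apply_self]
    have hne : Function.update (flip G σ u (τ v)) v (τ v) u ≠ τ u := by
      rw [hval, ← h.eq_of_ne u huv]; exact hut.symm
    have hset := kempeComponent_eq_of_mem_moves hτ hne
    rw [hval] at hset
    -- In `τ` the edge `uv` alternates between the two colors, so a move of `τ` that gives `u` the
    -- color `τ v` also recolors `v`.
    have hmem : v ∈ kempeComponent G τ u (τ v) :=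
      mem_kempeComponent_of_adj (self_mem_kempeComponent _ _ _) ⟨hvu.symm, Or.inl ⟨rfl, rfl⟩⟩
    rw [hset] at hmem
    simp at hmem

theorem hammingDist_update {σ τ ρ : Coloring V k} {v : V} (h : DifferAt σ τ v)
    (hρ : ρ v = σ v) : hammingDist τ (Function.update ρ v (τ v)) = hammingDist σ ρ := by
  rw [hammingDist, hammingDist]
  congr 1
  ext w
  simp only [Finset.mem_filter, Finset.mem_univ, true_and]
  by_cases hw : w = v
  · subst hw; simp [hρ]
  · rw [Function.update_of_ne hw, h.eq_of_ne w hw]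

theorem update_mem_common {σ τ ρ : Coloring V k} {v : V} (h : ρ ∈ common G σ τ v) :
    Function.update ρ v (τ v) ∈ common G τ σ v := by
  obtain ⟨h₁, h₂, h₃⟩ := mem_common.1 h
  refine mem_common.2 ⟨h₃, by simp, ?_⟩
  rw [Function.update_idem, ← h₂, Function.update_eq_self]
  exact h₁

theorem sum_common_symm (σ τ : Coloring V k) (v : V) (F : Coloring V k → ℝ) :
    ∑ ρ ∈ common G τ σ v, F ρ = ∑ ρ ∈ common G σ τ v, F (Function.update ρ v (τ v)) := by
  symm
  refine Finset.sum_nbij' (fun ρ => Function.update ρ v (τ v))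
    (fun ρ => Function.update ρ v (σ v)) (fun ρ hρ => update_mem_common hρ)
    (fun ρ hρ => update_mem_common hρ) ?_ ?_ (fun _ _ => rfl)
  · intro ρ hρ
    simp only [Function.update_idem]
    rw [← (mem_common.1 hρ).2.1, Function.update_eq_self]
  · intro ρ hρ
    simp only [Function.update_idem]
    rw [← (mem_common.1 hρ).2.1, Function.update_eq_self]

/-- The rate of the move of `u` in `solo G σ τ v`, shared among the neighbors of `v` in the same
component. -/
def soloRate (G : SimpleGraph V) (σ τ : Coloring V k) (v u : V) : ℝ :=
  pStar (kempeComponent G σ u (τ v)).card / mult (solo G σ τ v) (fun u => flip G σ u (τ v)) u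

theorem soloRate_nonneg (σ τ : Coloring V k) (v u : V) : 0 ≤ soloRate G σ τ v u :=
  div_nonneg (pStar_nonneg _) (Nat.cast_nonneg _)

theorem soloRate_le {σ τ : Coloring V k} {v u : V} (hu : u ∈ solo G σ τ v) :
    soloRate G σ τ v u ≤ pStar (kempeComponent G σ u (τ v)).card :=
  div_le_self (pStar_nonneg _) (one_le_mult hu)

theorem DifferAt.sum_moves_eq {σ τ : Coloring V k} {v : V} (h : DifferAt σ τ v)
    (F : Coloring V k → ℝ) :
    ∑ ρ ∈ (moves G σ).filter (fun ρ => ρ v = σ v), pStar (hammingDist σ ρ) * F ρ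
      = ∑ ρ ∈ common G σ τ v, pStar (hammingDist σ ρ) * F ρ
        + ∑ u ∈ solo G σ τ v, soloRate G σ τ v u * F (flip G σ u (τ v)) := by
  rw [← Finset.sum_filter_add_sum_filter_not _
    (fun ρ => Function.update ρ v (τ v) ∈ moves G τ), Finset.filter_filter, Finset.filter_filter,
    h.filter_moves_eq_image, ← sum_div_mult]
  congr 1
  refine Finset.sum_congr rfl fun u hu => ?_
  rw [soloRate, hammingDist_flip (mem_solo.1 hu).2.1.symm]
  ring

theorem sum_moves_ne_eq (σ : Coloring V k) (v : V) (F : Coloring V k → ℝ) :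
    ∑ ρ ∈ (moves G σ).filter (fun ρ => ¬ ρ v = σ v), F ρ
      = ∑ c ∈ Finset.univ.erase (σ v), F (flip G σ v c) := by
  symm
  refine Finset.sum_nbij' (fun c => flip G σ v c) (fun ρ => ρ v) ?_ ?_ ?_ ?_ (fun _ _ => rfl)
  · intro c hc
    have hc := Finset.ne_of_mem_erase hc
    refine Finset.mem_filter.2 ⟨flip_mem_moves hc, ?_⟩
    rw [flip_apply_self]; exact hc
  · intro ρ hρ
    exact Finset.mem_erase.2 ⟨(Finset.mem_filter.1 hρ).2, Finset.mem_univ _⟩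
  · intro c _
    exact flip_apply_self _ _ _
  · intro ρ hρ
    obtain ⟨h₁, h₂⟩ := Finset.mem_filter.1 hρ
    exact eq_flip_of_mem_moves h₁ h₂

theorem DifferAt.gen_eq {σ τ : Coloring V k} {v : V} (h : DifferAt σ τ v)
    (f : Coloring V k → ℝ) :
    gen G f σ = ∑ c ∈ Finset.univ.erase (σ v),
        pStar (kempeComponent G σ v c).card * (f (flip G σ v c) - f σ)
      + ∑ u ∈ solo G σ τ v, soloRate G σ τ v u * (f (flip G σ u (τ v)) - f σ)
      + ∑ ρ ∈ common G σ τ v, pStar (hammingDist σ ρ) * (f ρ - f σ) := by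
  rw [gen, ← Finset.sum_filter_add_sum_filter_not _ (fun ρ => ρ v = σ v),
    h.sum_moves_eq (fun ρ => f ρ - f σ), sum_moves_ne_eq]
  have : ∀ c ∈ Finset.univ.erase (σ v),
      pStar (hammingDist σ (flip G σ v c)) * (f (flip G σ v c) - f σ)
      = pStar (kempeComponent G σ v c).card * (f (flip G σ v c) - f σ) := by
    intro c hc
    rw [hammingDist_flip (Finset.ne_of_mem_erase hc)]
  rw [Finset.sum_congr rfl this]
  ring

/-- The total rate of the moves that fix the color of `v`. -/
theorem sum_rate_le (σ : Coloring V k) (v : V) :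
    ∑ ρ ∈ (moves G σ).filter (fun ρ => ρ v = σ v), pStar (hammingDist σ ρ)
      ≤ ((Fintype.card V : ℝ) - 1) * (k - 1) := by
  have h := sum_flips (G := G) σ (F := fun ρ => if ρ ≠ σ ∧ ρ v = σ v then 1 else 0) (by simp)
  have hne : ∀ ρ ∈ moves G σ, ρ ≠ σ := fun ρ hρ => by
    obtain ⟨u, c, hc, rfl⟩ := mem_moves.1 hρ; exact flip_ne hc
  have h₁ : ∑ ρ ∈ (moves G σ).filter (fun ρ => ρ v = σ v), pStar (hammingDist σ ρ)
      = ∑ ρ ∈ moves G σ, pStar (hammingDist σ ρ) * (if ρ ≠ σ ∧ ρ v = σ v then 1 else 0) := by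
    rw [Finset.sum_filter]
    refine Finset.sum_congr rfl fun ρ hρ => ?_
    by_cases hv : ρ v = σ v <;> simp [hv, hne ρ hρ]
  rw [h₁, ← h]
  -- The pairs with `u = v` recolor `v`, and those with `c = σ u` are not moves; this leaves `(n -
  -- 1)(k - 1)` pairs.
  have hterm : ∀ u c, pStar (kempeComponent G σ u c).card / ((kempeComponent G σ u c).card : ℝ)
      * (if flip G σ u c ≠ σ ∧ flip G σ u c v = σ v then 1 else 0)
      ≤ if u ≠ v then (if c ≠ σ u then 1 else 0) else 0 := by
    intro u c
    have hq : pStar (kempeComponent G σ u c).card / ((kempeComponent G σ u c).card : ℝ) ≤ 1 := by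
      have : (1 : ℝ) ≤ (kempeComponent G σ u c).card := by
        exact_mod_cast Finset.card_pos.2 ⟨u, self_mem_kempeComponent _ _ _⟩
      exact (div_le_self (pStar_nonneg _) this).trans (pStar_le_one _)
    by_cases hc : c = σ u
    · subst hc; simp [flip_self]
    · by_cases huv : u = v
      · subst huv; simp [flip_apply_self, hc]
      · rw [if_pos huv, if_pos hc]
        split_ifs
        · simpa using hq
        · simp
  refine (Finset.sum_le_sum fun u _ => Finset.sum_le_sum fun c _ => hterm u c).trans ?_
  have hin : ∀ u, ∑ c : Fin k, (if u ≠ v then (if c ≠ σ u then (1 : ℝ) else 0) else 0)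
      = if u ≠ v then (k : ℝ) - 1 else 0 := by
    intro u
    split_ifs
    · rw [← Finset.sum_filter, Finset.sum_const, Finset.filter_ne', Finset.card_erase_of_mem
        (Finset.mem_univ _), Finset.card_univ, Fintype.card_fin, nsmul_eq_mul, mul_one,
        Nat.cast_pred (Fin.pos (σ u))]
    · simp
  rw [Finset.sum_congr rfl fun u _ => hin u, ← Finset.sum_filter, Finset.sum_const,
    Finset.filter_ne', Finset.card_erase_of_mem (Finset.mem_univ _), Finset.card_univ,
    nsmul_eq_mul, Nat.cast_pred (Fintype.card_pos_iff.2 ⟨v⟩)]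

/-! ### Grouping by colors -/

/-- The color of `v` in `σ` is neither `c` nor `τ v`, so no component for these two colors reaches
`v`. -/
theorem solo_filter_eq_nbrs {σ τ : Coloring V k} {v : V} {c : Fin k} (hσ : c ≠ σ v)
    (hτ : c ≠ τ v) (hne : σ v ≠ τ v) :
    (solo G σ τ v).filter (fun u => σ u = c) = nbrs G σ v c := by
  ext u
  simp only [Finset.mem_filter, mem_solo, mem_nbrs]
  constructor
  · rintro ⟨⟨h, _⟩, hc⟩
    exact ⟨h, hc⟩
  · rintro ⟨h, rfl⟩
    refine ⟨⟨h, hτ, fun hv => ?_⟩, rfl⟩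
    rcases color_of_mem_kempeComponent hv with h | h
    · exact hσ h.symm
    · exact hne h

/-- Members of `solo` in one component avoid the color `τ v`, hence have equal colors; sharing takes
place within one color class. -/
theorem mult_solo {σ τ : Coloring V k} {v u : V} (hu : u ∈ solo G σ τ v) :
    mult (solo G σ τ v) (fun u => flip G σ u (τ v)) u
      = mult ((solo G σ τ v).filter fun w => σ w = σ u) (fun u => flip G σ u (τ v)) u := by
  rw [mult, mult]
  congr 1
  ext w
  simp only [Finset.mem_filter]
  refine ⟨fun ⟨h₁, h₂⟩ => ⟨⟨h₁, ?_⟩, h₂⟩, fun ⟨h₁, h₂⟩ => ⟨h₁.1, h₂⟩⟩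
  have hmem : w ∈ kempeComponent G σ u (τ v) := by
    rw [← flip_apply_ne_iff (mem_solo.1 hu).2.1.symm, ← h₂, flip_apply_self]
    exact (mem_solo.1 h₁).2.1.symm
  exact (color_of_mem_kempeComponent hmem).resolve_right (mem_solo.1 h₁).2.1

/-! ### The contribution of one color -/

/-- The neighbors of `u` other than `v` that have color `s` or `t`. -/
def busy (G : SimpleGraph V) (ρ : Coloring V k) (v : V) (s t : Fin k) (u : V) : Finset V :=
  Finset.univ.filter fun w => G.Adj u w ∧ w ≠ v ∧ (ρ w = s ∨ ρ w = t)

theorem mem_busy {ρ : Coloring V k} {v u w : V} {s t : Fin k} :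
    w ∈ busy G ρ v s t u ↔ G.Adj u w ∧ w ≠ v ∧ (ρ w = s ∨ ρ w = t) := by simp [busy]

theorem hammingDist_le_card {x y : Coloring V k} {X : Finset V} (h : ∀ w, w ∉ X → x w = y w) :
    hammingDist x y ≤ X.card := by
  refine Finset.card_le_card fun w hw => ?_
  by_contra hX
  exact (Finset.mem_filter.1 hw).2 (h w hX)

namespace DifferAt

variable {σ τ : Coloring V k} {v : V}

theorem nbrs_eq (h : DifferAt σ τ v) (c : Fin k) : nbrs G τ v c = nbrs G σ v c := by
  ext u
  simp only [mem_nbrs]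
  refine and_congr_right fun hu => ?_
  rw [h.eq_of_ne u hu.ne']

theorem notMem_of_mem_nbrs (h : DifferAt σ τ v) {c : Fin k} (hτ : c ≠ τ v) {u : V}
    (hu : u ∈ nbrs G σ v c) : v ∉ kempeComponent G τ u (σ v) := by
  obtain ⟨hvu, huc⟩ := mem_nbrs.1 hu
  intro hv
  rcases color_of_mem_kempeComponent hv with e | e
  · rw [← h.eq_of_ne u hvu.ne', huc] at e; exact hτ e.symm
  · exact h.ne e.symm

theorem kempeComponent_eq_of_mem_nbrs (h : DifferAt σ τ v) {c : Fin k} {u : V}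
    (hu : u ∈ nbrs G σ v c) (hv : v ∉ kempeComponent G τ u (σ v)) :
    kempeComponent G τ u (σ v) = branch G σ v c (σ v) u := by
  obtain ⟨hvu, huc⟩ := mem_nbrs.1 hu
  rw [kempeComponent_eq_branch hv, branch_congr h.symm.eq_of_ne, ← h.eq_of_ne u hvu.ne', huc]

/-- Two neighbors of `v` of the same color give the same flip exactly if they lie in one
component. -/
theorem flip_eq_flip_iff (h : DifferAt σ τ v) {c : Fin k} (hσ : c ≠ σ v) {u w : V}
    (hu : u ∈ nbrs G σ v c) (hw : w ∈ nbrs G σ v c) :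
    flip G τ w (σ v) = flip G τ u (σ v) ↔ w ∈ kempeComponent G τ u (σ v) := by
  obtain ⟨hvu, huc⟩ := mem_nbrs.1 hu
  obtain ⟨hvw, hwc⟩ := mem_nbrs.1 hw
  have huτ : τ u = c := by rw [← h.eq_of_ne u hvu.ne', huc]
  have hwτ : τ w = c := by rw [← h.eq_of_ne w hvw.ne', hwc]
  constructor
  · intro e
    rw [← flip_apply_ne_iff (huτ ▸ hσ.symm), ← e, flip_apply_self, hwτ]
    exact hσ.symm
  · intro e
    have := flip_flip_apply e
    rwa [flip_of_color_eq e (hwτ.trans huτ.symm)] at this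

theorem kempeComponent_eq_of_mem (h : DifferAt σ τ v) {c : Fin k} {u w : V}
    (hu : u ∈ nbrs G σ v c) (hw : w ∈ nbrs G σ v c) (e : w ∈ kempeComponent G τ u (σ v)) :
    kempeComponent G τ w (σ v) = kempeComponent G τ u (σ v) := by
  have hvu := (mem_nbrs.1 hu).1
  have hvw := (mem_nbrs.1 hw).1
  have huτ : τ u = c := by rw [← h.eq_of_ne u hvu.ne', (mem_nbrs.1 hu).2]
  have hwτ : τ w = c := by rw [← h.eq_of_ne w hvw.ne', (mem_nbrs.1 hw).2]
  have := kempeComponent_flip_apply e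
  rwa [flip_of_color_eq e (hwτ.trans huτ.symm)] at this

/-- The component of `v` is the disjoint union of `v` and the distinct branches; dividing by `mult`
counts a branch with several neighbors of `v` once. -/
theorem card_kempeComponent_eq (h : DifferAt σ τ v) {c : Fin k} (hσ : c ≠ σ v)
    (hv : ∀ u ∈ nbrs G σ v c, v ∉ kempeComponent G τ u (σ v)) :
    ((kempeComponent G σ v c).card : ℝ) = 1 + ∑ u ∈ nbrs G σ v c,
      ((kempeComponent G τ u (σ v)).card : ℝ)
        / mult (nbrs G σ v c) (fun u => flip G τ u (σ v)) u := by
  set U := nbrs G σ v c with hU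
  set C : V → Finset V := fun u => kempeComponent G τ u (σ v) with hC
  have hunion : kempeComponent G σ v c = insert v (U.biUnion C) := by
    rw [kempeComponent_eq_insert hσ]
    congr 1
    refine Finset.biUnion_congr rfl fun u hu => ?_
    exact (h.kempeComponent_eq_of_mem_nbrs hu (hv u hu)).symm
  have hvn : v ∉ U.biUnion C := by
    intro hmem
    obtain ⟨u, hu, hvu⟩ := Finset.mem_biUnion.1 hmem
    exact hv u hu hvu
  have hmult : ∀ u ∈ U, mult U (fun u => flip G τ u (σ v)) u = mult U C u := by
    intro u hu
    rw [mult, mult]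
    congr 1
    refine Finset.filter_congr fun w hw => ?_
    rw [h.flip_eq_flip_iff hσ hu hw]
    refine ⟨fun e => h.kempeComponent_eq_of_mem hu hw e, fun e => ?_⟩
    have : w ∈ C w := self_mem_kempeComponent _ _ _
    rwa [e] at this
  have hcard : (U.biUnion C).card = ∑ z ∈ U.image C, z.card := by
    have : U.biUnion C = (U.image C).biUnion id := by
      rw [Finset.image_biUnion]; rfl
    rw [this, Finset.card_biUnion]
    · rfl
    · intro x hx y hy hxy
      obtain ⟨u, hu, rfl⟩ := Finset.mem_image.1 hx
      obtain ⟨w, hw, rfl⟩ := Finset.mem_image.1 hy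
      refine Finset.disjoint_left.2 fun z hzu hzw => hxy ?_
      have h₁ := kempeComponent_flip_apply (G := G) (σ := τ) hzu
      have hwτ : τ w = τ u := by
        rw [← h.eq_of_ne w (mem_nbrs.1 hw).1.ne', ← h.eq_of_ne u (mem_nbrs.1 hu).1.ne',
          (mem_nbrs.1 hw).2, (mem_nbrs.1 hu).2]
      have h₂ := kempeComponent_flip_apply (G := G) (σ := τ) hzw
      have hval : flip G τ u (σ v) z = flip G τ w (σ v) z := by
        by_cases e : τ z = τ u
        · rw [flip_of_color_eq hzu e, flip_of_color_eq hzw (e.trans hwτ.symm)]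
        · rw [flip_of_color_ne hzu e, flip_of_color_ne hzw (hwτ ▸ e), hwτ]
      change kempeComponent G τ u (σ v) = kempeComponent G τ w (σ v)
      rw [← h₁, ← h₂, hval]
  rw [hunion, Finset.card_insert_of_notMem hvn, hcard]
  push_cast
  rw [← sum_div_mult U C (fun z => (z.card : ℝ)), add_comm]
  congr 1
  exact Finset.sum_congr rfl fun u hu => by rw [hmult u hu]

end DifferAt

/-- The components in `τ` that the component of `v` in `σ` for the color `c` consists of. -/
def colorBranches {σ τ : Coloring V k} {v : V} (h : DifferAt σ τ v) {c : Fin k} (hσ : c ≠ σ v)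
    (hτ : c ≠ τ v) {U : Finset V} (hU : nbrs G σ v c = U) (hne : U.Nonempty) :
    Branches (Coloring V k) U where
  key u := flip G τ u (σ v)
  size u := (kempeComponent G τ u (σ v)).card
  top := (U.exists_max_image (fun u => (kempeComponent G τ u (σ v)).card) hne).choose
  total := (kempeComponent G σ v c).card
  size_congr u hu w hw e := by
    subst hU
    rw [h.kempeComponent_eq_of_mem hw hu ((h.flip_eq_flip_iff hσ hw hu).1 e)]
  top_mem := (U.exists_max_image (fun u => (kempeComponent G τ u (σ v)).card) hne).choose_spec.1
  size_le_top :=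
    (U.exists_max_image (fun u => (kempeComponent G τ u (σ v)).card) hne).choose_spec.2
  mult_le u hu := by
    subst hU
    refine Finset.card_le_card fun w hw => ?_
    obtain ⟨hw, e⟩ := Finset.mem_filter.1 hw
    exact (h.flip_eq_flip_iff hσ hu hw).1 e
  total_eq := by
    subst hU
    exact h.card_kempeComponent_eq hσ fun u hu => h.notMem_of_mem_nbrs hτ hu

namespace DifferAt

variable {σ τ : Coloring V k} {v : V}

theorem hammingDist_flip_right_le (h : DifferAt σ τ v) {u : V} :
    hammingDist σ (flip G τ u (σ v)) ≤ (kempeComponent G τ u (σ v)).card + 1 := by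
  refine (hammingDist_le_card (X := insert v (kempeComponent G τ u (σ v))) fun w hw => ?_).trans
    (Finset.card_insert_le _ _)
  rw [Finset.mem_insert, not_or] at hw
  rw [flip_of_notMem hw.2, h.eq_of_ne w hw.1]

/-- The extra disagreement at `v` is offset by `u`, which lies in both components. This is the unit
saved by pairing the two flips. -/
theorem hammingDist_flip_flip_le (h : DifferAt σ τ v) {u : V} :
    hammingDist (flip G σ u (τ v)) (flip G τ u (σ v))
      ≤ (kempeComponent G τ u (σ v)).card + (kempeComponent G σ u (τ v)).card := by
  set C := kempeComponent G τ u (σ v) with hC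
  set D := kempeComponent G σ u (τ v) with hD
  have h₁ : hammingDist (flip G σ u (τ v)) (flip G τ u (σ v)) ≤ (insert v (C ∪ D)).card := by
    refine hammingDist_le_card fun w hw => ?_
    simp only [Finset.mem_insert, Finset.mem_union, not_or] at hw
    rw [flip_of_notMem hw.2.1, flip_of_notMem hw.2.2, h.eq_of_ne w hw.1]
  have h₂ := Finset.card_insert_le v (C ∪ D)
  have h₃ := Finset.card_union_add_card_inter C D
  have h₄ : 0 < (C ∩ D).card := Finset.card_pos.2 ⟨u, Finset.mem_inter.2
    ⟨self_mem_kempeComponent _ _ _, self_mem_kempeComponent _ _ _⟩⟩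
  omega

/-- Flipping the whole component in `σ` and one of its branches in `τ`. -/
theorem flip_eq_flip_of_mem (h : DifferAt σ τ v) {c : Fin k} {u w : V}
    (hu : u ∈ nbrs G σ v c) (hv : v ∉ kempeComponent G τ u (σ v))
    (hw : w ∈ kempeComponent G τ u (σ v) ∨ (w ∉ kempeComponent G σ v c ∧ w ≠ v))
    (hσ : c ≠ σ v) : flip G σ v c w = flip G τ u (σ v) w := by
  have hsub : kempeComponent G τ u (σ v) ⊆ kempeComponent G σ v c := by
    rw [kempeComponent_eq_insert hσ, h.kempeComponent_eq_of_mem_nbrs hu hv]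
    exact (Finset.subset_biUnion_of_mem (branch G σ v c (σ v)) hu).trans
      (Finset.subset_insert _ _)
  obtain ⟨hvu, huc⟩ := mem_nbrs.1 hu
  have huτ : τ u = c := by rw [← h.eq_of_ne u hvu.ne', huc]
  rcases hw with hw | hw
  · have hwv : w ≠ v := by rintro rfl; exact hv hw
    have hcol := color_of_mem_kempeComponent hw
    rw [huτ] at hcol
    rcases hcol with e | e
    · rw [flip_of_color_eq hw (e.trans huτ.symm), flip_of_color_ne (hsub hw)]
      rw [h.eq_of_ne w hwv, e]; exact hσ
    · rw [flip_of_color_ne hw (by rw [e, huτ]; exact hσ.symm), flip_of_color_eq (hsub hw), huτ]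
      rw [h.eq_of_ne w hwv, e]
  · rw [flip_of_notMem hw.1, flip_of_notMem fun hw' => hw.1 (hsub hw'), h.eq_of_ne w hw.2]

theorem hammingDist_flip_top_le (h : DifferAt σ τ v) {c : Fin k} {u : V}
    (hu : u ∈ nbrs G σ v c) (hv : v ∉ kempeComponent G τ u (σ v)) (hσ : c ≠ σ v) :
    (hammingDist (flip G σ v c) (flip G τ u (σ v)) : ℝ)
      ≤ (kempeComponent G σ v c).card - (kempeComponent G τ u (σ v)).card := by
  have hsub : kempeComponent G τ u (σ v) ⊆ kempeComponent G σ v c := by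
    rw [kempeComponent_eq_insert hσ, h.kempeComponent_eq_of_mem_nbrs hu hv]
    exact (Finset.subset_biUnion_of_mem (branch G σ v c (σ v)) hu).trans
      (Finset.subset_insert _ _)
  have h₁ : hammingDist (flip G σ v c) (flip G τ u (σ v))
      ≤ (kempeComponent G σ v c \ kempeComponent G τ u (σ v)).card := by
    refine hammingDist_le_card fun w hw => h.flip_eq_flip_of_mem hu hv ?_ hσ
    rw [Finset.mem_sdiff, not_and, not_not] at hw
    by_cases hw' : w ∈ kempeComponent G τ u (σ v)
    · exact Or.inl hw'
    · refine Or.inr ⟨fun h' => hw' (hw h'), ?_⟩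
      rintro rfl
      exact hw' (hw (self_mem_kempeComponent _ _ _))
  rw [Finset.card_sdiff_of_subset hsub] at h₁
  rw [← Nat.cast_sub (Finset.card_le_card hsub)]
  exact_mod_cast h₁

/-- A neighbor of `v` whose configuration may be extremal has one or two busy neighbors. -/
theorem isSlack_of_card_busy (h : DifferAt σ τ v) {c : Fin k} (hσ : c ≠ σ v) (hτ : c ≠ τ v) {u : V}
    (hu : u ∈ nbrs G σ v c)
    (hN : (busy G σ v (σ v) (τ v) u).card ≠ 1 ∧ (busy G σ v (σ v) (τ v) u).card ≠ 2) :
    IsSlack (kempeComponent G τ u (σ v)).card (kempeComponent G σ u (τ v)).card := by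
  obtain ⟨hvu, huc⟩ := mem_nbrs.1 hu
  have huτ : τ u = c := by rw [← h.eq_of_ne u hvu.ne', huc]
  set N := busy G σ v (σ v) (τ v) u with hNdef
  rcases Nat.eq_zero_or_pos N.card with h₀ | h₀
  · have hN₀ := Finset.card_eq_zero.1 h₀
    left
    constructor
    · refine Finset.card_eq_one.2 ⟨u, Finset.Subset.antisymm
        (kempeComponent_subset (Finset.mem_singleton_self u) ?_)
        (Finset.singleton_subset_iff.2 (self_mem_kempeComponent _ _ _))⟩
      intro a b hab ha
      obtain rfl := Finset.mem_singleton.1 ha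
      exfalso
      have hb : τ b = σ v := by
        rcases hab.2 with e | e
        · exact e.2
        · exact absurd (huτ.symm.trans e.1) hσ
      have hbv : b ≠ v := by rintro rfl; exact h.ne hb.symm
      have : b ∈ N := mem_busy.2 ⟨hab.1, hbv, Or.inl (by rw [h.eq_of_ne b hbv, hb])⟩
      rw [hN₀] at this
      exact Finset.notMem_empty _ this
    · refine Finset.card_eq_one.2 ⟨u, Finset.Subset.antisymm
        (kempeComponent_subset (Finset.mem_singleton_self u) ?_)
        (Finset.singleton_subset_iff.2 (self_mem_kempeComponent _ _ _))⟩
      intro a b hab ha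
      obtain rfl := Finset.mem_singleton.1 ha
      exfalso
      have hb : σ b = τ v := by
        rcases hab.2 with e | e
        · exact e.2
        · exact absurd (huc.symm.trans e.1) hτ
      have hbv : b ≠ v := by rintro rfl; exact h.ne hb
      have : b ∈ N := mem_busy.2 ⟨hab.1, hbv, Or.inr hb⟩
      rw [hN₀] at this
      exact Finset.notMem_empty _ this
  · right
    have hsub : N ⊆ (kempeComponent G τ u (σ v)).erase u
        ∪ (kempeComponent G σ u (τ v)).erase u := by
      intro w hw
      obtain ⟨huw, hwv, hcol⟩ := mem_busy.1 hw
      rw [Finset.mem_union, Finset.mem_erase, Finset.mem_erase]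
      rcases hcol with e | e
      · left
        refine ⟨huw.ne', mem_kempeComponent_of_adj (self_mem_kempeComponent _ _ _)
          ⟨huw, Or.inl ⟨rfl, ?_⟩⟩⟩
        rw [← h.eq_of_ne w hwv, e]
      · right
        exact ⟨huw.ne', mem_kempeComponent_of_adj (self_mem_kempeComponent _ _ _)
          ⟨huw, Or.inl ⟨rfl, e⟩⟩⟩
    have h₁ := (Finset.card_le_card hsub).trans (Finset.card_union_le _ _)
    rw [Finset.card_erase_of_mem (self_mem_kempeComponent _ _ _),
      Finset.card_erase_of_mem (self_mem_kempeComponent _ _ _)] at h₁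
    have h₂ : 0 < (kempeComponent G τ u (σ v)).card :=
      Finset.card_pos.2 ⟨u, self_mem_kempeComponent _ _ _⟩
    have h₃ : 0 < (kempeComponent G σ u (τ v)).card :=
      Finset.card_pos.2 ⟨u, self_mem_kempeComponent _ _ _⟩
    omega

theorem rate_colorBranches (h : DifferAt σ τ v) {c : Fin k} (hσ : c ≠ σ v) (hτ : c ≠ τ v)
    {U : Finset V} (hU : nbrs G σ v c = U) (hne : U.Nonempty) {u : V} (hu : u ∈ U) :
    (colorBranches h hσ hτ hU hne).rate u = soloRate G τ σ v u := by
  have hU' : U = (solo G τ σ v).filter fun w => τ w = c := by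
    rw [solo_filter_eq_nbrs hτ hσ h.ne.symm, h.nbrs_eq, hU]
  have huc : τ u = c := by
    rw [hU'] at hu; exact (Finset.mem_filter.1 hu).2
  have hus : u ∈ solo G τ σ v := by
    rw [hU'] at hu; exact (Finset.mem_filter.1 hu).1
  rw [soloRate, mult_solo hus, huc, ← hU']
  rfl

/-- The contribution of a color other than the two colors of `v`. -/
theorem color_le (h : DifferAt σ τ v) {c : Fin k} (hσ : c ≠ σ v) (hτ : c ≠ τ v)
    {f : Coloring V k → ℝ} (hf : ∀ x y, f x - f y ≤ hammingDist x y) (hL : f σ - f τ ≤ 1) :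
    pStar (kempeComponent G σ v c).card * (f (flip G σ v c) - f σ)
      - pStar (kempeComponent G τ v c).card * (f (flip G τ v c) - f τ)
      + ∑ u ∈ nbrs G σ v c, soloRate G σ τ v u * (f (flip G σ u (τ v)) - f σ)
      - ∑ u ∈ nbrs G σ v c, soloRate G τ σ v u * (f (flip G τ u (σ v)) - f τ)
    ≤ ∑ u ∈ nbrs G σ v c, (11 / 6 - 1 / 264 * (if (busy G σ v (σ v) (τ v) u).card ≠ 1
          ∧ (busy G σ v (σ v) (τ v) u).card ≠ 2 then 1 else 0)) - 1
      + (1 + ∑ u ∈ nbrs G σ v c, soloRate G σ τ v u + ∑ u ∈ nbrs G σ v c, soloRate G τ σ v u)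
        * (1 - (f σ - f τ)) := by
  rcases (nbrs G σ v c).eq_empty_or_nonempty with hemp | hne
  · have hAσ : kempeComponent G σ v c = {v} := by
      rw [kempeComponent_eq_insert hσ, hemp]; simp
    have hAτ : kempeComponent G τ v c = {v} := by
      rw [kempeComponent_eq_insert hτ, h.nbrs_eq, hemp]; simp
    have heq : flip G σ v c = flip G τ v c := by
      funext w
      by_cases hw : w = v
      · subst hw; rw [flip_apply_self, flip_apply_self]
      · rw [flip_of_notMem (by rw [hAσ]; simpa using hw),
          flip_of_notMem (by rw [hAτ]; simpa using hw), h.eq_of_ne w hw]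
    -- Both flips recolor `v` alone, at rate `1`, and lead to the same coloring; this is the `-1` of
    -- a color.
    rw [hAσ, hAτ, hemp, heq, Finset.card_singleton, show pStar 1 = 1 from rfl]
    simp only [Finset.sum_empty]
    linarith
  · set S := colorBranches h hσ hτ rfl hne with hS
    set T := colorBranches h.symm hτ hσ (h.nbrs_eq c) hne with hT
    have hrS : ∀ u ∈ nbrs G σ v c, soloRate G τ σ v u = S.rate u := fun u hu =>
      (h.rate_colorBranches hσ hτ rfl hne hu).symm
    have hrT : ∀ u ∈ nbrs G σ v c, soloRate G σ τ v u = T.rate u := fun u hu =>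
      (h.symm.rate_colorBranches hτ hσ (h.nbrs_eq c) hne hu).symm
    have e₁ : ∑ u ∈ nbrs G σ v c, soloRate G σ τ v u * (f (flip G σ u (τ v)) - f σ)
        = ∑ u ∈ nbrs G σ v c, T.leftover u * (f (T.key u) - f σ)
          + pStar T.total * (f (T.key T.top) - f σ) := by
      rw [T.sum_leftover_mul (fun x => f x - f σ)]
      rw [sub_add_cancel]
      exact Finset.sum_congr rfl fun u hu => by rw [hrT u hu]; rfl
    have e₂ : ∑ u ∈ nbrs G σ v c, soloRate G τ σ v u * (f (flip G τ u (σ v)) - f τ)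
        = ∑ u ∈ nbrs G σ v c, S.leftover u * (f (S.key u) - f τ)
          + pStar S.total * (f (S.key S.top) - f τ) := by
      rw [S.sum_leftover_mul (fun x => f x - f τ)]
      rw [sub_add_cancel]
      exact Finset.sum_congr rfl fun u hu => by rw [hrS u hu]; rfl
    rw [e₁, e₂, Finset.sum_congr rfl hrS, Finset.sum_congr rfl hrT]
    have hcost := cost_le S T
    have hslack : ∑ u ∈ nbrs G σ v c, (11 / 6 - 1 / 264 *
        (if (busy G σ v (σ v) (τ v) u).card ≠ 1 ∧ (busy G σ v (σ v) (τ v) u).card ≠ 2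
          then (1 : ℝ) else 0)) ≥ 11 / 6 * (nbrs G σ v c).card
            - 1 / 264 * ((nbrs G σ v c).filter fun u => IsSlack (S.size u) (T.size u)).card := by
      rw [Finset.sum_sub_distrib, Finset.sum_const, nsmul_eq_mul, ← Finset.mul_sum,
        ← Finset.sum_filter, Finset.sum_const, nsmul_eq_mul, mul_one]
      have : ((nbrs G σ v c).filter fun u => (busy G σ v (σ v) (τ v) u).card ≠ 1
          ∧ (busy G σ v (σ v) (τ v) u).card ≠ 2).card
          ≤ ((nbrs G σ v c).filter fun u => IsSlack (S.size u) (T.size u)).card := by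
        refine Finset.card_le_card fun u hu => ?_
        obtain ⟨h₁, h₂⟩ := Finset.mem_filter.1 hu
        exact Finset.mem_filter.2 ⟨h₁, h.isSlack_of_card_busy hσ hτ h₁ h₂⟩
      have : (((nbrs G σ v c).filter fun u => (busy G σ v (σ v) (τ v) u).card ≠ 1
          ∧ (busy G σ v (σ v) (τ v) u).card ≠ 2).card : ℝ)
          ≤ ((nbrs G σ v c).filter fun u => IsSlack (S.size u) (T.size u)).card := by
        exact_mod_cast this
      linarith
    -- The flip of the whole component in `σ` is paired, at its full rate, with the flip of its
    -- largest branch in `τ`; `hB` is the same with the colorings exchanged.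
    have hA : pStar S.total * ((f (flip G σ v c) - f σ) - (f (S.key S.top) - f τ))
        ≤ pStar S.total * (S.total - S.size S.top - (f σ - f τ)) := by
      refine mul_le_mul_of_nonneg_left ?_ (pStar_nonneg _)
      have := (hf _ _).trans (h.hammingDist_flip_top_le S.top_mem
        (h.notMem_of_mem_nbrs hτ S.top_mem) hσ)
      change _ - f (S.key S.top) ≤ (S.total : ℝ) - S.size S.top at this
      linarith
    have hB : pStar T.total * ((f (T.key T.top) - f σ) - (f (flip G τ v c) - f τ))
        ≤ pStar T.total * (T.total - T.size T.top - (f σ - f τ)) := by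
      refine mul_le_mul_of_nonneg_left ?_ (pStar_nonneg _)
      have hmem : T.top ∈ nbrs G τ v c := by rw [h.nbrs_eq]; exact T.top_mem
      have h₁ := h.symm.hammingDist_flip_top_le hmem (h.symm.notMem_of_mem_nbrs hσ hmem) hτ
      rw [hammingDist_comm] at h₁
      have := (hf _ _).trans h₁
      change f (T.key T.top) - _ ≤ (T.total : ℝ) - T.size T.top at this
      linarith
    have hterm : ∀ u ∈ nbrs G σ v c,
        T.leftover u * (f (T.key u) - f σ) - S.leftover u * (f (S.key u) - f τ)
        ≤ S.size u * S.leftover u + T.size u * T.leftover u - min (S.leftover u) (T.leftover u)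
          + (S.leftover u + T.leftover u) * (1 - (f σ - f τ)) := by
      intro u hu
      have hα := S.leftover_nonneg hu
      have hβ := T.leftover_nonneg hu
      have d₁ : f (T.key u) - f (S.key u) ≤ S.size u + T.size u :=
        (hf _ _).trans (by exact_mod_cast h.hammingDist_flip_flip_le)
      have d₂ : f σ - f (S.key u) ≤ S.size u + 1 :=
        (hf _ _).trans (by exact_mod_cast h.hammingDist_flip_right_le)
      have d₃ : f (T.key u) - f τ ≤ T.size u + 1 := by
        refine (hf _ _).trans ?_
        rw [hammingDist_comm]
        exact_mod_cast h.symm.hammingDist_flip_right_le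
      set α := S.leftover u
      set β := T.leftover u
      have h1L : 0 ≤ 1 - (f σ - f τ) := by linarith
      -- The two leftover flips at `u` are paired at rate `min α β`, with distance at most the sum
      -- of the two sizes. The excess rate of the larger one is paired with staying put.
      rcases min_cases α β with ⟨e, hle⟩ | ⟨e, hle⟩ <;> rw [e]
      · have m₁ := mul_le_mul_of_nonneg_left d₁ hα
        have m₂ := mul_le_mul_of_nonneg_left d₃ (sub_nonneg.2 hle)
        have m₃ := mul_nonneg hα h1L
        linarith
      · have m₁ := mul_le_mul_of_nonneg_left d₁ hβ
        have m₂ := mul_le_mul_of_nonneg_left d₂ (sub_nonneg.2 hle.le)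
        have m₃ := mul_nonneg hβ h1L
        linarith
    have hsum := Finset.sum_le_sum hterm
    simp only [Finset.sum_sub_distrib, Finset.sum_add_distrib, ← Finset.sum_mul] at hsum
    rw [S.sum_leftover, T.sum_leftover] at hsum
    rw [Branches.cost, Branches.cost] at hcost
    have hAB : (kempeComponent G σ v c).card = S.total ∧ (kempeComponent G τ v c).card = T.total :=
      ⟨rfl, rfl⟩
    rw [hAB.1, hAB.2]
    linarith

end DifferAt

/-! ### The contribution of all colors -/

theorem sum_contributions_le {ι : Type*} {O : Finset ι} {x y z w a r r' : ι → ℝ} {q : ℝ}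
    (h : ∀ c ∈ O, x c - y c + z c - w c ≤ a c - 1 + (1 + r c + r' c) * q) :
    ∑ c ∈ O, x c - ∑ c ∈ O, y c + ∑ c ∈ O, z c - ∑ c ∈ O, w c
      ≤ ∑ c ∈ O, a c - ∑ _c ∈ O, (1 : ℝ)
        + (∑ _c ∈ O, (1 : ℝ) + ∑ c ∈ O, r c + ∑ c ∈ O, r' c) * q := by
  have := Finset.sum_le_sum h
  simpa only [Finset.sum_sub_distrib, Finset.sum_add_distrib, ← Finset.sum_mul] using this

namespace DifferAt

variable {σ τ : Coloring V k} {v : V}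

/-- The contribution of the neighbors that have the color of `v`. -/
theorem swap_le (h : DifferAt σ τ v) {f : Coloring V k → ℝ}
    (hf : ∀ x y, f x - f y ≤ hammingDist x y) (hL : f σ - f τ ≤ 1) :
    pStar (kempeComponent G σ v (τ v)).card * (f (flip G σ v (τ v)) - f σ)
      - ∑ u ∈ (solo G τ σ v).filter (fun u => τ u = τ v),
          soloRate G τ σ v u * (f (flip G τ u (σ v)) - f τ)
    ≤ ∑ _u ∈ nbrs G σ v (τ v), (11 / 6 - 1 / 264 : ℝ) - 1 + (1 - (f σ - f τ)) := by
  set M := nbrs G σ v (τ v) with hM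
  set W := (solo G τ σ v).filter (fun u => τ u = τ v) with hW
  set A := (kempeComponent G σ v (τ v)).card with hA
  have hWM : W ⊆ M := by
    intro u hu
    obtain ⟨h₁, h₂⟩ := Finset.mem_filter.1 hu
    rw [hM, ← h.nbrs_eq]
    exact mem_nbrs.2 ⟨(mem_solo.1 h₁).1, h₂⟩
  have hpA := pStar_nonneg A
  have hpA1 := pStar_le_one A
  have hA1 : 1 ≤ A := Finset.card_pos.2 ⟨v, self_mem_kempeComponent _ _ _⟩
  have hham : f (flip G σ v (τ v)) - f τ ≤ A - 1 := by
    have h₁ : hammingDist (flip G σ v (τ v)) τ ≤ ((kempeComponent G σ v (τ v)).erase v).card := by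
      refine hammingDist_le_card fun w hw => ?_
      by_cases hwv : w = v
      · rw [hwv, flip_apply_self]
      · rw [flip_of_notMem fun hw' => hw (Finset.mem_erase.2 ⟨hwv, hw'⟩), h.eq_of_ne w hwv]
    rw [Finset.card_erase_of_mem (self_mem_kempeComponent _ _ _)] at h₁
    refine (hf _ _).trans ?_
    rw [← Nat.cast_pred hA1]
    exact_mod_cast h₁
  have hone : ∀ u : V, f τ - f (flip G τ u (σ v)) ≤ (kempeComponent G τ u (σ v)).card := by
    intro u
    refine (hf _ _).trans ?_
    have h₁ : hammingDist τ (flip G τ u (σ v)) ≤ (kempeComponent G τ u (σ v)).card :=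
      hammingDist_le_card fun w hw => (flip_of_notMem hw).symm
    exact_mod_cast h₁
  have h1L : 0 ≤ 1 - (f σ - f τ) := by linarith
  have hmain : pStar A * (f (flip G σ v (τ v)) - f σ)
      ≤ (A - 2) * pStar A + (1 - (f σ - f τ)) := by
    have h₁ := mul_le_mul_of_nonneg_left hham hpA
    have h₂ := mul_le_mul_of_nonneg_right hpA1 h1L
    linarith
  have hsum : -∑ u ∈ W, soloRate G τ σ v u * (f (flip G τ u (σ v)) - f τ) ≤ W.card := by
    rw [← Finset.sum_neg_distrib, ← nsmul_one, ← Finset.sum_const]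
    refine Finset.sum_le_sum fun u hu => ?_
    have hr := soloRate_le (Finset.mem_filter.1 hu).1
    have h₁ := mul_le_mul_of_nonneg_left (hone u) (soloRate_nonneg (G := G) τ σ v u)
    have h₂ := mul_le_mul_of_nonneg_right hr
      (Nat.cast_nonneg (α := ℝ) (kempeComponent G τ u (σ v)).card)
    have h₃ := mul_pStar_le_one (kempeComponent G τ u (σ v)).card
    linarith
  have hA2 := sub_two_mul_pStar_le A
  rw [Finset.sum_const, nsmul_eq_mul]
  -- With no neighbor in `M` the flip at `v` turns `σ` into `τ`. With at least two, the crude bound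
  -- of `1` per flip in `W` and `94/462` for the flip at `v` is enough.
  rcases (by omega : M.card = 0 ∨ M.card = 1 ∨ 2 ≤ M.card) with hm | hm | hm
  · have hM₀ := Finset.card_eq_zero.1 hm
    have hW₀ : W = ∅ := Finset.subset_empty.1 (hM₀ ▸ hWM)
    have : A = 1 := by
      rw [hA, kempeComponent_eq_insert h.ne.symm, ← hM, hM₀]; simp
    rw [this, show pStar 1 = 1 from rfl] at hmain ⊢
    rw [hW₀, hm]
    push_cast at hmain ⊢
    simp only [Finset.sum_empty]
    linarith
  · obtain ⟨u, hu⟩ := Finset.card_eq_one.1 hm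
    rw [hm]
    by_cases huW : u ∈ W
    · have hWu : W = {u} := Finset.Subset.antisymm (hu ▸ hWM) (Finset.singleton_subset_iff.2 huW)
      have hus := (Finset.mem_filter.1 huW).1
      have hut := (Finset.mem_filter.1 huW).2
      have hv := (mem_solo.1 hus).2.2
      have huM : u ∈ nbrs G σ v (τ v) := hWM huW
      have hset : kempeComponent G σ v (τ v) = insert v (kempeComponent G τ u (σ v)) := by
        rw [kempeComponent_eq_insert h.ne.symm, ← hM, hu, Finset.singleton_biUnion,
          h.kempeComponent_eq_of_mem_nbrs huM hv]
      have hAc : A = (kempeComponent G τ u (σ v)).card + 1 := by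
        rw [hA, hset, Finset.card_insert_of_notMem hv]
      have hrate : soloRate G τ σ v u = pStar (kempeComponent G τ u (σ v)).card := by
        rw [soloRate, mult_solo hus, hut, ← hW, hWu, mult_singleton, Nat.cast_one, div_one]
      -- The two flips end in the same coloring, so they are paired at the smaller rate `pStar (a +
      -- 1)`.
      have heq : flip G σ v (τ v) = flip G τ u (σ v) := by
        funext w
        by_cases hwv : w = v
        · rw [hwv, flip_apply_self, flip_of_notMem hv]
        · refine h.flip_eq_flip_of_mem huM hv ?_ h.ne.symm
          rw [hset, Finset.mem_insert]
          tauto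
      rw [hWu, Finset.sum_singleton, hrate, heq, hAc]
      set a := (kempeComponent G τ u (σ v)).card with ha
      have ha1 : 1 ≤ a := Finset.card_pos.2 ⟨u, self_mem_kempeComponent _ _ _⟩
      have hpa := pStar_nonneg (a + 1)
      have hpa1 := pStar_le_one (a + 1)
      have h₁ := mul_le_mul_of_nonneg_left (hone u) (sub_nonneg.2 (pStar_succ_le ha1))
      rw [← ha] at h₁
      have h₂ := mul_nonneg (sub_nonneg.2 hpa1) h1L
      have h₃ : a * pStar a - (a + 1) * pStar (a + 1) ≤ 5 / 6 - 1 / 264 := by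
        rcases ha1.eq_or_lt with h' | h'
        · rw [← h']; norm_num [pStar]
        · have := mul_pStar_le h'
          have : 0 ≤ ((a : ℝ) + 1) * pStar (a + 1) := by positivity
          linarith
      push_cast
      linarith
    · have hW₀ : W = ∅ := by
        refine Finset.eq_empty_of_forall_notMem fun w hw => huW ?_
        have := hWM hw
        rw [hu, Finset.mem_singleton] at this
        rwa [← this]
      rw [hW₀]
      push_cast
      simp only [Finset.sum_empty]
      linarith
  · have h₁ : (W.card : ℝ) ≤ M.card := by exact_mod_cast Finset.card_le_card hWM
    have h₂ : (2 : ℝ) ≤ M.card := by exact_mod_cast hm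
    linarith

theorem sum_solo_eq (h : DifferAt σ τ v) (F : V → ℝ) :
    ∑ u ∈ solo G σ τ v, F u = ∑ u ∈ (solo G σ τ v).filter (fun u => σ u = σ v), F u
      + ∑ c ∈ (Finset.univ.erase (σ v)).erase (τ v), ∑ u ∈ nbrs G σ v c, F u := by
  rw [← Finset.sum_fiberwise_of_maps_to (t := Finset.univ) (g := σ) (fun _ _ => Finset.mem_univ _),
    ← Finset.add_sum_erase _ _ (Finset.mem_univ (σ v)),
    ← Finset.add_sum_erase _ _ (Finset.mem_erase.2 ⟨h.ne.symm, Finset.mem_univ (τ v)⟩)]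
  have : (solo G σ τ v).filter (fun u => σ u = τ v) = ∅ :=
    Finset.filter_eq_empty_iff.2 fun u hu => (mem_solo.1 hu).2.1
  rw [this, Finset.sum_empty, zero_add]
  congr 1
  refine Finset.sum_congr rfl fun c hc => ?_
  have h₁ := Finset.ne_of_mem_erase hc
  have h₂ := Finset.ne_of_mem_erase (Finset.mem_of_mem_erase hc)
  rw [solo_filter_eq_nbrs h₂ h₁ h.ne]

theorem sum_nbrs_eq (h : DifferAt σ τ v) (F : V → ℝ) :
    ∑ u ∈ Finset.univ.filter (G.Adj v), F u
      = ∑ u ∈ nbrs G σ v (σ v), F u + ∑ u ∈ nbrs G σ v (τ v), F u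
        + ∑ c ∈ (Finset.univ.erase (σ v)).erase (τ v), ∑ u ∈ nbrs G σ v c, F u := by
  rw [← Finset.sum_fiberwise_of_maps_to (t := Finset.univ) (g := σ) (fun _ _ => Finset.mem_univ _),
    ← Finset.add_sum_erase _ _ (Finset.mem_univ (σ v)),
    ← Finset.add_sum_erase _ _ (Finset.mem_erase.2 ⟨h.ne.symm, Finset.mem_univ (τ v)⟩)]
  simp only [Finset.filter_filter, nbrs, add_assoc]

theorem sum_erase_erase_one (h : DifferAt σ τ v) :
    ∑ _c ∈ (Finset.univ.erase (σ v)).erase (τ v), (1 : ℝ) = k - 2 := by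
  have hk : 2 ≤ k := by
    have := h.ne
    have h₁ := (σ v).isLt
    have h₂ := (τ v).isLt
    have : (σ v : ℕ) ≠ τ v := fun e => h.ne (Fin.ext e)
    omega
  rw [Finset.sum_const, Finset.card_erase_of_mem
    (Finset.mem_erase.2 ⟨h.ne.symm, Finset.mem_univ (τ v)⟩),
    Finset.card_erase_of_mem (Finset.mem_univ _), Finset.card_univ, Fintype.card_fin, nsmul_eq_mul,
    mul_one, Nat.sub_sub, Nat.cast_sub hk]
  norm_num

/-- Distances after a move are measured here by the Hamming distance. As `f σ - f τ` may be smaller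
than `1`, the deficit `1 - (f σ - f τ)` is charged at the rate of all moves involved. Common moves
are kept apart, since only on them the change of the weight is exploited. -/
theorem gen_sub_gen_le (h : DifferAt σ τ v) {f : Coloring V k → ℝ}
    (hf : ∀ x y, f x - f y ≤ hammingDist x y) (hL : f σ - f τ ≤ 1) :
    gen G f σ - gen G f τ
    ≤ ∑ u ∈ Finset.univ.filter (G.Adj v), (11 / 6 - 1 / 264 *
        (if (busy G σ v (σ v) (τ v) u).card ≠ 1 ∧ (busy G σ v (σ v) (τ v) u).card ≠ 2
          then 1 else 0)) - k
      + (k + ∑ u ∈ solo G σ τ v, soloRate G σ τ v u + ∑ u ∈ solo G τ σ v, soloRate G τ σ v u)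
        * (1 - (f σ - f τ))
      + ∑ ρ ∈ common G σ τ v, pStar (hammingDist σ ρ)
        * (f ρ - f (Function.update ρ v (τ v)) - (f σ - f τ)) := by
  have h1L : 0 ≤ 1 - (f σ - f τ) := by linarith
  have hcom : ∑ ρ ∈ common G τ σ v, pStar (hammingDist τ ρ) * (f ρ - f τ)
      = ∑ ρ ∈ common G σ τ v, pStar (hammingDist σ ρ)
        * (f (Function.update ρ v (τ v)) - f τ) := by
    rw [sum_common_symm σ τ v (fun ρ => pStar (hammingDist τ ρ) * (f ρ - f τ))]
    exact Finset.sum_congr rfl fun ρ hρ => by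
      rw [hammingDist_update h (mem_common.1 hρ).2.1]
  have hcom' : ∑ ρ ∈ common G σ τ v, pStar (hammingDist σ ρ)
        * (f ρ - f (Function.update ρ v (τ v)) - (f σ - f τ))
      = ∑ ρ ∈ common G σ τ v, pStar (hammingDist σ ρ) * (f ρ - f σ)
        - ∑ ρ ∈ common G σ τ v, pStar (hammingDist σ ρ)
          * (f (Function.update ρ v (τ v)) - f τ) := by
    rw [← Finset.sum_sub_distrib]
    exact Finset.sum_congr rfl fun ρ _ => by ring
  have hO : (Finset.univ.erase (τ v)).erase (σ v) = (Finset.univ.erase (σ v)).erase (τ v) :=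
    Finset.erase_right_comm
  rw [h.gen_eq f, h.symm.gen_eq f, hcom, hcom', h.sum_solo_eq, h.sum_solo_eq (soloRate G σ τ v),
    h.symm.sum_solo_eq, h.symm.sum_solo_eq (soloRate G τ σ v), h.sum_nbrs_eq, hO,
    ← Finset.add_sum_erase _ _ (Finset.mem_erase.2 ⟨h.ne.symm, Finset.mem_univ (τ v)⟩),
    ← Finset.add_sum_erase _ _ (Finset.mem_erase.2 ⟨h.ne, Finset.mem_univ (σ v)⟩), hO]
  simp only [h.nbrs_eq]
  have hcol : ∀ c ∈ (Finset.univ.erase (σ v)).erase (τ v), _ := fun c hc =>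
    h.color_le (G := G) (Finset.ne_of_mem_erase (Finset.mem_of_mem_erase hc))
      (Finset.ne_of_mem_erase hc) hf hL
  have hcols := sum_contributions_le hcol
  rw [h.sum_erase_erase_one] at hcols
  have hst := h.swap_le (G := G) hf hL
  -- Exchanging `σ` and `τ` reverses the sign of the difference, which passing to `-f` restores.
  have hts := h.symm.swap_le (G := G) (f := fun x => -f x) (fun x y => by
    have := hf y x
    rw [hammingDist_comm] at this
    linarith) (by linarith)
  rw [h.nbrs_eq] at hts
  have hneg : ∑ u ∈ (solo G σ τ v).filter (fun u => σ u = σ v),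
        soloRate G σ τ v u * (-f (flip G σ u (τ v)) - -f σ)
      = -∑ u ∈ (solo G σ τ v).filter (fun u => σ u = σ v),
        soloRate G σ τ v u * (f (flip G σ u (τ v)) - f σ) := by
    rw [← Finset.sum_neg_distrib]
    exact Finset.sum_congr rfl fun u _ => by ring
  rw [hneg] at hts
  have hmono : ∀ c, ∑ _u ∈ nbrs G σ v c, (11 / 6 - 1 / 264 : ℝ)
      ≤ ∑ u ∈ nbrs G σ v c, (11 / 6 - 1 / 264 *
        (if (busy G σ v (σ v) (τ v) u).card ≠ 1 ∧ (busy G σ v (σ v) (τ v) u).card ≠ 2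
          then 1 else 0)) := by
    intro c
    refine Finset.sum_le_sum fun u _ => ?_
    split_ifs <;> norm_num
  have hm₁ := hmono (σ v)
  have hm₂ := hmono (τ v)
  have hr₁ := mul_nonneg (Finset.sum_nonneg fun u (_ : u ∈ (solo G σ τ v).filter
    (fun u => σ u = σ v)) => soloRate_nonneg (G := G) σ τ v u) h1L
  have hr₂ := mul_nonneg (Finset.sum_nonneg fun u (_ : u ∈ (solo G τ σ v).filter
    (fun u => τ u = τ v)) => soloRate_nonneg (G := G) τ σ v u) h1L
  linarith

end DifferAt

/-! ### The weights of the edges and their drift -/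

/-- The discount for a neighbor of `v` with `N` busy neighbors. -/
def discount : ℕ → ℝ
  | 0 => 16 / 15
  | 1 => 1 / 15
  | _ => 0

theorem discount_of_le {N : ℕ} (h : 2 ≤ N) : discount N = 0 := by
  obtain ⟨M, rfl⟩ := Nat.exists_eq_add_of_le' h
  rfl

theorem discount_nonneg (N : ℕ) : 0 ≤ discount N := by
  rcases (by omega : N = 0 ∨ N = 1 ∨ 2 ≤ N) with rfl | rfl | h
  · norm_num [discount]
  · norm_num [discount]
  · rw [discount_of_le h]

theorem discount_le (N : ℕ) : discount N ≤ 16 / 15 := by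
  rcases (by omega : N = 0 ∨ N = 1 ∨ 2 ≤ N) with rfl | rfl | h
  · norm_num [discount]
  · norm_num [discount]
  · rw [discount_of_le h]; norm_num

/-- The discount is decreasing and convex: its successive drops are `1`, `1/15`, `0, …`. So `g`
further busy neighbors cost at most `g` times the first drop. -/
theorem discount_sub_le {N M g : ℕ} (h : M ≤ N + g) :
    discount N - discount M ≤ (discount N - discount (N + 1)) * g := by
  have hM := discount_nonneg M
  rcases (by omega : N = 0 ∨ N = 1 ∨ 2 ≤ N) with rfl | rfl | hN
  · rcases (by omega : M = 0 ∨ M = 1 ∨ 2 ≤ M) with rfl | rfl | hM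
    · norm_num [discount]
    · have : (1 : ℝ) ≤ g := by exact_mod_cast (by omega : 1 ≤ g)
      norm_num [discount]; linarith
    · have : (2 : ℝ) ≤ g := by exact_mod_cast (by omega : 2 ≤ g)
      rw [discount_of_le hM]; norm_num [discount]; linarith
  · rcases (by omega : M = 0 ∨ M = 1 ∨ 2 ≤ M) with rfl | rfl | hM
    · have : (0 : ℝ) ≤ g := Nat.cast_nonneg g
      norm_num [discount]; linarith
    · norm_num [discount]
    · have : (1 : ℝ) ≤ g := by exact_mod_cast (by omega : 1 ≤ g)
      rw [discount_of_le hM]; norm_num [discount]; linarith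
  · rw [discount_of_le hN, discount_of_le (by omega : 2 ≤ N + 1)]; linarith

theorem discount_succ_le (N : ℕ) : discount (N + 1) ≤ discount N := by
  have := discount_sub_le (N := N + 1) (M := N) (g := 0) (by omega)
  simp only [Nat.cast_zero, mul_zero] at this
  linarith

/-- The total discount of the edge from `σ` to the coloring that gives `v` the color `t`. -/
def totalDiscount (G : SimpleGraph V) (σ : Coloring V k) (v : V) (s t : Fin k) : ℝ :=
  ∑ u ∈ Finset.univ.filter (G.Adj v), discount (busy G σ v s t u).card

/-- The weight of the edge from `σ` to the coloring that gives `v` the color `t`. -/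
def edgeWeight (G : SimpleGraph V) (γ : ℝ) (σ : Coloring V k) (v : V) (t : Fin k) : ℝ :=
  1 - γ * totalDiscount G σ v (σ v) t

theorem totalDiscount_nonneg (σ : Coloring V k) (v : V) (s t : Fin k) :
    0 ≤ totalDiscount G σ v s t := Finset.sum_nonneg fun _ _ => discount_nonneg _

theorem edgeWeight_le_one {γ : ℝ} (hγ : 0 ≤ γ) (σ : Coloring V k) (v : V) (t : Fin k) :
    edgeWeight G γ σ v t ≤ 1 := by
  have := mul_nonneg hγ (totalDiscount_nonneg (G := G) σ v (σ v) t)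
  rw [edgeWeight]; linarith

theorem le_edgeWeight {γ : ℝ} (hγ : 0 ≤ γ) {Δ : ℕ}
    (hΔ : ∀ w, (Finset.univ.filter (G.Adj w)).card ≤ Δ) (σ : Coloring V k) (v : V) (t : Fin k) :
    1 - γ * (16 / 15 * Δ) ≤ edgeWeight G γ σ v t := by
  have h₁ : totalDiscount G σ v (σ v) t ≤ 16 / 15 * Δ := by
    refine (Finset.sum_le_sum fun u _ => discount_le _).trans ?_
    rw [Finset.sum_const, nsmul_eq_mul, mul_comm]
    have : ((Finset.univ.filter (G.Adj v)).card : ℝ) ≤ Δ := by exact_mod_cast hΔ v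
    linarith
  have := mul_le_mul_of_nonneg_left h₁ hγ
  rw [edgeWeight]; linarith

/-! ### Rates at which busy neighbors appear and disappear -/

/-- Only one move gives `w` the new color `z`, and its rate is at most `1`. -/
theorem sum_moves_recolor_le (σ : Coloring V k) {X : Finset (Coloring V k)} (hX : X ⊆ moves G σ)
    (w : V) (z : Fin k) :
    ∑ ρ ∈ X, pStar (hammingDist σ ρ) * (if ρ w = z ∧ σ w ≠ z then (1 : ℝ) else 0) ≤ 1 := by
  have hle : ∀ ρ ∈ X, pStar (hammingDist σ ρ) * (if ρ w = z ∧ σ w ≠ z then (1 : ℝ) else 0)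
      ≤ if ρ = flip G σ w z then 1 else 0 := by
    intro ρ hρ
    by_cases h : ρ w = z ∧ σ w ≠ z
    · have : ρ = flip G σ w z := by
        rw [← h.1, eq_flip_of_mem_moves (hX hρ) (h.1 ▸ h.2.symm)]
      rw [if_pos h, if_pos this, mul_one]
      exact pStar_le_one _
    · rw [if_neg h, mul_zero]
      split_ifs <;> norm_num
  refine (Finset.sum_le_sum hle).trans ?_
  rw [Finset.sum_ite_eq']
  split_ifs <;> norm_num

theorem flip_eq_update_of_forall_ne {σ : Coloring V k} {u : V} {c : Fin k} (hc : c ≠ σ u)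
    (h : ∀ w, G.Adj u w → σ w ≠ c) : flip G σ u c = Function.update σ u c := by
  have hS : kempeComponent G σ u c = {u} := by
    refine Finset.Subset.antisymm (kempeComponent_subset (Finset.mem_singleton_self u) ?_)
      (Finset.singleton_subset_iff.2 (self_mem_kempeComponent _ _ _))
    intro a b hab ha
    obtain rfl := Finset.mem_singleton.1 ha
    rcases hab.2 with e | e
    · exact absurd e.2 (h b hab.1)
    · exact absurd e.1.symm hc
  funext w
  by_cases hw : w = u
  · subst hw; rw [flip_apply_self, Function.update_self]
  · rw [Function.update_of_ne hw, flip_of_notMem (by rw [hS]; simpa using hw)]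

namespace DifferAt

variable {σ τ : Coloring V k} {v : V}

theorem update_mem_common (h : DifferAt σ τ v) {w : V} (hwv : w ≠ v) {y : Fin k}
    (hy : ∀ z, G.Adj w z → σ z ≠ y) (hyw : y ≠ σ w) (hyt : y ≠ τ v) :
    Function.update σ w y ∈ common G σ τ v ∧ hammingDist σ (Function.update σ w y) = 1 := by
  have h₁ := flip_eq_update_of_forall_ne hyw hy
  have hτ : ∀ z, G.Adj w z → τ z ≠ y := by
    intro z hz
    by_cases hzv : z = v
    · rw [hzv]; exact hyt.symm
    · rw [← h.eq_of_ne z hzv]; exact hy z hz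
  have h₂ := flip_eq_update_of_forall_ne (h.eq_of_ne w hwv ▸ hyw) hτ
  refine ⟨mem_common.2 ⟨h₁ ▸ flip_mem_moves hyw, Function.update_of_ne hwv.symm _ _, ?_⟩, ?_⟩
  · rw [Function.update_comm hwv, h.update_eq, ← h₂]
    exact flip_mem_moves (h.eq_of_ne w hwv ▸ hyw)
  · rw [hammingDist, Finset.card_eq_one]
    refine ⟨w, ?_⟩
    ext z
    by_cases hz : z = w
    · subst hz; simp [hyw.symm]
    · simp [hz]

/-- Each of the at most `Δ` neighbors of `u` becomes busy through one of two colors, each at rate at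
most `1`. -/
theorem sum_gained_le {Δ : ℕ}
    (hΔ : ∀ w, (Finset.univ.filter (G.Adj w)).card ≤ Δ) (u : V) :
    ∑ ρ ∈ common G σ τ v, pStar (hammingDist σ ρ)
      * ((busy G ρ v (σ v) (τ v) u \ busy G σ v (σ v) (τ v) u).card : ℝ) ≤ 2 * Δ := by
  have hg : ∀ ρ, ((busy G ρ v (σ v) (τ v) u \ busy G σ v (σ v) (τ v) u).card : ℝ)
      ≤ ∑ w ∈ Finset.univ.filter (G.Adj u), ((if ρ w = σ v ∧ σ w ≠ σ v then (1 : ℝ) else 0)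
        + (if ρ w = τ v ∧ σ w ≠ τ v then (1 : ℝ) else 0)) := by
    intro ρ
    have hsub : busy G ρ v (σ v) (τ v) u \ busy G σ v (σ v) (τ v) u
        ⊆ Finset.univ.filter (G.Adj u) := fun w hw => by
      simpa using (mem_busy.1 (Finset.mem_sdiff.1 hw).1).1
    rw [← nsmul_one, ← Finset.sum_const]
    refine le_trans (Finset.sum_le_sum fun w hw => ?_) (Finset.sum_le_sum_of_subset_of_nonneg hsub
      fun w _ _ => ?_)
    · obtain ⟨h₁, h₂⟩ := Finset.mem_sdiff.1 hw
      obtain ⟨ha, hwv, hcol⟩ := mem_busy.1 h₁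
      have hn : ¬ (σ w = σ v ∨ σ w = τ v) := fun e => h₂ (mem_busy.2 ⟨ha, hwv, e⟩)
      rw [not_or] at hn
      rcases hcol with e | e
      · rw [if_pos ⟨e, hn.1⟩]
        split_ifs <;> norm_num
      · rw [if_pos (⟨e, hn.2⟩ : ρ w = τ v ∧ σ w ≠ τ v)]
        split_ifs <;> norm_num
    · split_ifs <;> norm_num
  have hsub : common G σ τ v ⊆ moves G σ := Finset.filter_subset _ _
  calc _ ≤ ∑ ρ ∈ common G σ τ v, pStar (hammingDist σ ρ)
        * ∑ w ∈ Finset.univ.filter (G.Adj u), ((if ρ w = σ v ∧ σ w ≠ σ v then (1 : ℝ) else 0)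
        + (if ρ w = τ v ∧ σ w ≠ τ v then (1 : ℝ) else 0)) :=
        Finset.sum_le_sum fun ρ _ => mul_le_mul_of_nonneg_left (hg ρ) (pStar_nonneg _)
    _ = ∑ w ∈ Finset.univ.filter (G.Adj u),
        (∑ ρ ∈ common G σ τ v, pStar (hammingDist σ ρ)
            * (if ρ w = σ v ∧ σ w ≠ σ v then (1 : ℝ) else 0)
          + ∑ ρ ∈ common G σ τ v, pStar (hammingDist σ ρ)
            * (if ρ w = τ v ∧ σ w ≠ τ v then (1 : ℝ) else 0)) := by
        simp only [Finset.mul_sum]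
        rw [Finset.sum_comm]
        refine Finset.sum_congr rfl fun w _ => ?_
        rw [← Finset.sum_add_distrib]
        exact Finset.sum_congr rfl fun ρ _ => mul_add _ _ _
    _ ≤ ∑ _w ∈ Finset.univ.filter (G.Adj u), (2 : ℝ) := by
        refine Finset.sum_le_sum fun w _ => ?_
        have h₁ := sum_moves_recolor_le σ hsub w (σ v)
        have h₂ := sum_moves_recolor_le σ hsub w (τ v)
        linarith
    _ ≤ 2 * Δ := by
        rw [Finset.sum_const, nsmul_eq_mul, mul_comm]
        have : ((Finset.univ.filter (G.Adj u)).card : ℝ) ≤ Δ := by exact_mod_cast hΔ u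
        linarith

/-- A busy neighbor of `u` is recolored with a color that is not busy at a rate of at least
`k - Δ - 2`. -/
theorem exists_calming_moves (h : DifferAt σ τ v) {Δ : ℕ}
    (hΔ : ∀ w, (Finset.univ.filter (G.Adj w)).card ≤ Δ) {u : V}
    (hN : (busy G σ v (σ v) (τ v) u).card ≠ 0) :
    ∃ X ⊆ common G σ τ v, (k : ℝ) - Δ - 2 ≤ X.card ∧ ∀ ρ ∈ X, hammingDist σ ρ = 1 ∧
      busy G ρ v (σ v) (τ v) u ⊆ busy G σ v (σ v) (τ v) u ∧
      (busy G ρ v (σ v) (τ v) u).card = (busy G σ v (σ v) (τ v) u).card - 1 := by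
  obtain ⟨w, hw⟩ := Finset.card_ne_zero.1 hN
  obtain ⟨huw, hwv, hcol⟩ := mem_busy.1 hw
  -- A color outside `B` does not occur around `w` and is not busy. Recoloring `w` with it flips a
  -- single vertex, at rate `1`, in both colorings.
  set B := (Finset.univ.filter (G.Adj w)).image σ ∪ {σ v, τ v} with hB
  have hfree : ∀ y ∈ Bᶜ, (∀ z, G.Adj w z → σ z ≠ y) ∧ y ≠ σ v ∧ y ≠ τ v ∧ y ≠ σ w := by
    intro y hy
    rw [Finset.mem_compl, hB, Finset.mem_union, not_or] at hy
    have h₁ : y ≠ σ v := by rintro rfl; exact hy.2 (by simp)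
    have h₂ : y ≠ τ v := by rintro rfl; exact hy.2 (by simp)
    refine ⟨fun z hz e => hy.1 (Finset.mem_image.2 ⟨z, by simpa using hz, e⟩), h₁, h₂, ?_⟩
    rcases hcol with e | e <;> rw [e] <;> assumption
  refine ⟨Bᶜ.image fun y => Function.update σ w y, ?_, ?_, ?_⟩
  · intro ρ hρ
    obtain ⟨y, hy, rfl⟩ := Finset.mem_image.1 hρ
    obtain ⟨h₁, _, h₃, h₄⟩ := hfree y hy
    exact (h.update_mem_common hwv h₁ h₄ h₃).1
  · rw [Finset.card_image_of_injective _ (Function.update_injective σ w), Finset.card_compl,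
      Fintype.card_fin]
    have h₁ : B.card ≤ Δ + 2 := by
      refine (Finset.card_union_le _ _).trans ?_
      have := Finset.card_image_le (s := Finset.univ.filter (G.Adj w)) (f := σ)
      have := hΔ w
      have := Finset.card_le_two (a := σ v) (b := τ v)
      omega
    have h₂ : k ≤ (k - B.card) + (Δ + 2) := by omega
    have : (k : ℝ) ≤ ((k - B.card : ℕ) : ℝ) + (Δ + 2) := by exact_mod_cast h₂
    linarith
  · intro ρ hρ
    obtain ⟨y, hy, rfl⟩ := Finset.mem_image.1 hρ
    obtain ⟨h₁, h₂, h₃, h₄⟩ := hfree y hy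
    have hset : busy G (Function.update σ w y) v (σ v) (τ v) u
        = (busy G σ v (σ v) (τ v) u).erase w := by
      ext z
      rw [Finset.mem_erase, mem_busy, mem_busy]
      by_cases hz : z = w
      · subst hz
        simp [h₂, h₃]
      · simp [hz]
    refine ⟨(h.update_mem_common hwv h₁ h₄ h₃).2, ?_, ?_⟩
    · rw [hset]; exact Finset.erase_subset _ _
    · rw [hset, Finset.card_erase_of_mem hw]

/-- The drift of the discount of one neighbor. -/
theorem sum_discount_sub_le (h : DifferAt σ τ v) {Δ : ℕ}
    (hΔ : ∀ w, (Finset.univ.filter (G.Adj w)).card ≤ Δ) {u : V} {N : ℕ}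
    (hN : (busy G σ v (σ v) (τ v) u).card = N) :
    ∑ ρ ∈ common G σ τ v, pStar (hammingDist σ ρ)
      * (discount N - discount (busy G ρ v (σ v) (τ v) u).card)
    ≤ (discount N - discount (N + 1)) * (2 * Δ)
      - (if N = 0 then 0 else (discount (N - 1) - discount N) * (k - Δ - 2)) := by
  have hd := sub_nonneg.2 (discount_succ_le N)
  have hpt : ∀ ρ : Coloring V k, discount N - discount (busy G ρ v (σ v) (τ v) u).card
      ≤ (discount N - discount (N + 1))
        * ((busy G ρ v (σ v) (τ v) u \ busy G σ v (σ v) (τ v) u).card : ℝ) := by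
    intro ρ
    refine discount_sub_le ?_
    have := Finset.card_le_card_sdiff_add_card (s := busy G ρ v (σ v) (τ v) u)
      (t := busy G σ v (σ v) (τ v) u)
    omega
  have hg := mul_le_mul_of_nonneg_left (sum_gained_le (σ := σ) (τ := τ) (v := v) hΔ u) hd
  rw [Finset.mul_sum] at hg
  by_cases h₀ : N = 0
  · rw [if_pos h₀, sub_zero]
    refine le_trans (Finset.sum_le_sum fun ρ _ => ?_) hg
    have := mul_le_mul_of_nonneg_left (hpt ρ) (pStar_nonneg (hammingDist σ ρ))
    linarith
  · rw [if_neg h₀]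
    obtain ⟨X, hX, hcard, hXρ⟩ := h.exists_calming_moves (G := G) hΔ (u := u) (by rw [hN]; exact h₀)
    have he : 0 ≤ discount (N - 1) - discount N := by
      have := discount_succ_le (N - 1)
      rw [Nat.sub_add_cancel (Nat.pos_of_ne_zero h₀)] at this
      linarith
    -- Calming moves gain no busy neighbor, so the bound by gained neighbors is `0` on them and
    -- their benefit can be subtracted in full.
    have hpt' : ∀ ρ ∈ common G σ τ v, pStar (hammingDist σ ρ)
        * (discount N - discount (busy G ρ v (σ v) (τ v) u).card)
        ≤ (discount N - discount (N + 1)) * (pStar (hammingDist σ ρ)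
          * ((busy G ρ v (σ v) (τ v) u \ busy G σ v (σ v) (τ v) u).card : ℝ))
          - (if ρ ∈ X then (discount (N - 1) - discount N) else 0) := by
      intro ρ _
      by_cases hρ : ρ ∈ X
      · obtain ⟨e₁, e₂, e₃⟩ := hXρ ρ hρ
        rw [if_pos hρ, e₁, e₃, hN, Finset.sdiff_eq_empty_iff_subset.2 e₂,
          show pStar 1 = 1 from rfl]
        simp
      · rw [if_neg hρ, sub_zero]
        have := mul_le_mul_of_nonneg_left (hpt ρ) (pStar_nonneg (hammingDist σ ρ))
        linarith
    refine (Finset.sum_le_sum hpt').trans ?_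
    rw [Finset.sum_sub_distrib, ← Finset.sum_filter, Finset.filter_mem_eq_inter,
      Finset.inter_eq_right.2 hX, Finset.sum_const, nsmul_eq_mul]
    have := mul_le_mul_of_nonneg_right hcard he
    linarith

/-- Path coupling: the weight of an edge contracts if each neighbor contributes at most `T`. -/
theorem gen_sub_gen_le_of_forall (h : DifferAt σ τ v) {Δ : ℕ}
    (hΔ : ∀ w, (Finset.univ.filter (G.Adj w)).card ≤ Δ) {γ T : ℝ} (hγ : 0 ≤ γ)
    (hT : ∀ N : ℕ, 11 / 6 - 1 / 264 * (if N ≠ 1 ∧ N ≠ 2 then 1 else 0)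
      + γ * ((k + 2 * Δ) * discount N + (discount N - discount (N + 1)) * (2 * Δ)
        - (if N = 0 then 0 else (discount (N - 1) - discount N) * (k - Δ - 2))) ≤ T)
    {f : Coloring V k → ℝ} (hf : EdgeLipschitz (edgeWeight G γ) 1 f) :
    gen G f σ - gen G f τ
      ≤ (Fintype.card V : ℝ) * k * (edgeWeight G γ σ v (τ v) - (f σ - f τ))
        - k + T * (Finset.univ.filter (G.Adj v)).card := by
  have hfH : ∀ x y, f x - f y ≤ hammingDist x y := fun x y => by
    have := hf.sub_le zero_le_one (edgeWeight_le_one hγ) x y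
    linarith
  set L := f σ - f τ with hLdef
  set Z := totalDiscount G σ v (σ v) (τ v) with hZ
  have hZ0 : 0 ≤ Z := totalDiscount_nonneg _ _ _ _
  have hd : edgeWeight G γ σ v (τ v) = 1 - γ * Z := rfl
  have hL : L ≤ 1 - γ * Z := by
    have := hf σ v (τ v) h.ne.symm
    rw [h.update_eq, one_mul] at this
    exact this
  have hγZ := mul_nonneg hγ hZ0
  have hmain := h.gen_sub_gen_le (G := G) hfH (by linarith)
  set nb := Finset.univ.filter (G.Adj v) with hnb
  set R := ∑ u ∈ solo G σ τ v, soloRate G σ τ v u with hR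
  set R' := ∑ u ∈ solo G τ σ v, soloRate G τ σ v u with hR'
  set Q := ∑ ρ ∈ common G σ τ v, pStar (hammingDist σ ρ) with hQ
  have hnbΔ : (nb.card : ℝ) ≤ Δ := by exact_mod_cast hΔ v
  have hnbn : (nb.card : ℝ) ≤ Fintype.card V - 1 := by
    have h₁ : nb ⊆ Finset.univ.erase v := fun u hu => by
      have := (Finset.mem_filter.1 hu).2
      exact Finset.mem_erase.2 ⟨this.ne', Finset.mem_univ _⟩
    have h₂ := Finset.card_le_card h₁
    rw [Finset.card_erase_of_mem (Finset.mem_univ v), Finset.card_univ] at h₂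
    rw [← Nat.cast_pred (Fintype.card_pos_iff.2 ⟨v⟩)]
    exact_mod_cast h₂
  have hsolo : ∀ σ τ : Coloring V k, ∑ u ∈ solo G σ τ v, soloRate G σ τ v u ≤ nb.card := by
    intro σ τ
    refine (Finset.sum_le_sum fun u hu =>
      (soloRate_le hu).trans (pStar_le_one _)).trans ?_
    rw [Finset.sum_const, nsmul_one]
    have : solo G σ τ v ⊆ nb := fun u hu =>
      Finset.mem_filter.2 ⟨Finset.mem_univ _, (mem_solo.1 hu).1⟩
    exact_mod_cast Finset.card_le_card this
  have hRle := hsolo σ τ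
  have hR'le := hsolo τ σ
  have hQR : Q + R ≤ ((Fintype.card V : ℝ) - 1) * (k - 1) := by
    have h₁ := h.sum_moves_eq (G := G) (fun _ => 1)
    simp only [mul_one] at h₁
    rw [hQ, hR, ← h₁]
    exact sum_rate_le σ v
  -- Common and solo moves of `σ` have total rate at most `(n - 1)(k - 1)`, and `R' ≤ n - 1`; adding
  -- `k` gives `nk`. Hence the deficit of `f` against the weight is never charged more than the
  -- holding probability allows.
  have htot : k + R + R' + Q ≤ (Fintype.card V : ℝ) * k := by linarith
  have hcom : ∑ ρ ∈ common G σ τ v, pStar (hammingDist σ ρ)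
        * (f ρ - f (Function.update ρ v (τ v)) - L)
      ≤ Q * (1 - γ * Z - L) + γ * ∑ u ∈ nb, ∑ ρ ∈ common G σ τ v, pStar (hammingDist σ ρ)
        * (discount (busy G σ v (σ v) (τ v) u).card
          - discount (busy G ρ v (σ v) (τ v) u).card) := by
    rw [hQ, Finset.sum_mul, Finset.sum_comm, Finset.mul_sum, ← Finset.sum_add_distrib]
    refine Finset.sum_le_sum fun ρ hρ => ?_
    have hρv := (mem_common.1 hρ).2.1
    have h₁ := hf ρ v (τ v) (hρv ▸ h.ne.symm)
    rw [edgeWeight, hρv, one_mul] at h₁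
    have h₂ := mul_le_mul_of_nonneg_left h₁ (pStar_nonneg (hammingDist σ ρ))
    rw [← Finset.mul_sum, Finset.sum_sub_distrib]
    change _ ≤ pStar (hammingDist σ ρ) * (1 - γ * Z - L) + γ * (pStar (hammingDist σ ρ)
      * (Z - totalDiscount G ρ v (σ v) (τ v)))
    linarith
  have hsum : ∑ u ∈ nb, (11 / 6 - 1 / 264 *
        (if (busy G σ v (σ v) (τ v) u).card ≠ 1 ∧ (busy G σ v (σ v) (τ v) u).card ≠ 2
          then (1 : ℝ) else 0))
      + γ * ((k + 2 * Δ) * Z) + γ * ∑ u ∈ nb, ∑ ρ ∈ common G σ τ v, pStar (hammingDist σ ρ)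
        * (discount (busy G σ v (σ v) (τ v) u).card
          - discount (busy G ρ v (σ v) (τ v) u).card) ≤ T * nb.card := by
    have hTn : T * nb.card = ∑ _u ∈ nb, T := by rw [Finset.sum_const, nsmul_eq_mul, mul_comm]
    rw [hTn, hZ, totalDiscount, Finset.mul_sum, Finset.mul_sum, Finset.mul_sum,
      ← Finset.sum_add_distrib, ← Finset.sum_add_distrib]
    refine Finset.sum_le_sum fun u _ => ?_
    have h₁ := mul_le_mul_of_nonneg_left (h.sum_discount_sub_le hΔ (u := u) rfl) hγ
    have h₂ := hT (busy G σ v (σ v) (τ v) u).card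
    linarith
  have h₁ := mul_le_mul_of_nonneg_right htot (sub_nonneg.2 hL)
  -- The price of carrying the discount: moves that are not common start from distance `1 - γ Z`,
  -- but were estimated with distance `1`.
  have h₂ : (k + R + R') * (γ * Z) ≤ γ * ((k + 2 * Δ) * Z) := by
    have : (k : ℝ) + R + R' ≤ k + 2 * Δ := by linarith
    have := mul_le_mul_of_nonneg_right this hγZ
    linarith
  rw [hd]
  linarith

end DifferAt

/-! ### Mixing times -/

/-- Greedy coloring. -/
theorem exists_isProper {Δ : ℕ} (hΔ : ∀ w, (Finset.univ.filter (G.Adj w)).card ≤ Δ)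
    (hk : Δ < k) : ∃ σ : Coloring V k, IsProper G σ := by
  have key : ∀ S : Finset V, ∃ σ : Coloring V k, ∀ v ∈ S, ∀ w ∈ S, G.Adj v w → σ v ≠ σ w := by
    intro S
    induction S using Finset.induction_on with
    | empty => exact ⟨fun _ => ⟨0, by omega⟩, by simp⟩
    | insert a S ha ih =>
      obtain ⟨σ, hσ⟩ := ih
      obtain ⟨c, -, hc⟩ := Finset.exists_mem_notMem_of_card_lt_card
        (s := (Finset.univ.filter (G.Adj a)).image σ) (t := Finset.univ) (by
          rw [Finset.card_univ, Fintype.card_fin]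
          exact (Finset.card_image_le.trans (hΔ a)).trans_lt hk)
      have hc' : ∀ w, G.Adj a w → σ w ≠ c := fun w hw e =>
        hc (Finset.mem_image.2 ⟨w, by simpa using hw, e⟩)
      refine ⟨Function.update σ a c, fun v hv w hw hvw => ?_⟩
      by_cases hva : v = a
      · subst hva
        rw [Function.update_self, Function.update_of_ne hvw.ne']
        exact (hc' w hvw).symm
      · by_cases hwa : w = a
        · subst hwa
          rw [Function.update_self, Function.update_of_ne hva]
          exact hc' v hvw.symm
        · rw [Function.update_of_ne hva, Function.update_of_ne hwa]
          exact hσ v (Finset.mem_of_mem_insert_of_ne hv hva) w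
            (Finset.mem_of_mem_insert_of_ne hw hwa) hvw
  obtain ⟨σ, hσ⟩ := key Finset.univ
  exact ⟨σ, fun v w h => hσ v (Finset.mem_univ v) w (Finset.mem_univ w) h⟩

theorem FlipMixesWithin.mono {p : ℕ → ℝ} {T T' : ℝ} (h : FlipMixesWithin G k p T) (hT : T ≤ T') :
    FlipMixesWithin G k p T' := by
  obtain ⟨t, ht, hle⟩ := h
  exact ⟨t, ht, hle.trans hT⟩

/-- For empty `V` there is one coloring, at distance `0` from `π` at time `0`. For `k = 0` and
nonempty `V` there is none, and a supremum over the empty type is `0`. -/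
theorem flipMixesWithin_zero (p : ℕ → ℝ) (h : IsEmpty V ∨ k = 0) : FlipMixesWithin G k p 0 := by
  refine flipMixesWithin_of_worstDist_le (t := 0) ?_ (by simp)
  by_cases hV : IsEmpty V
  · have huniq : ∀ σ τ : Coloring V k, σ = τ := fun σ τ => Subsingleton.elim σ τ
    refine Real.iSup_le (fun σ => Real.iSup_le (fun A => ?_) (by norm_num)) (by norm_num)
    have hπ : ∀ τ : Coloring V k, (transition G k p ^ 0) σ τ = uniformProper G k τ := by
      intro τ
      have hprop : ∀ τ : Coloring V k, IsProper G τ := fun τ v => hV.elim v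
      have hcard : (Finset.univ.filter fun τ : Coloring V k => IsProper G τ) = {τ} :=
        Finset.eq_singleton_iff_unique_mem.2 ⟨Finset.mem_filter.2
          ⟨Finset.mem_univ _, hprop τ⟩, fun τ' _ => huniq τ' τ⟩
      obtain rfl := huniq σ τ
      rw [pow_zero, Matrix.one_apply_eq, uniformProper, if_pos (hprop σ), hcard]
      simp
    rw [Finset.sum_congr rfl fun τ _ => hπ τ, sub_self, abs_zero]
    norm_num
  · have hk := h.resolve_left hV
    subst hk
    obtain ⟨v⟩ := not_isEmpty_iff.1 hV
    have : IsEmpty (Coloring V 0) := ⟨fun σ => (σ v).elim0⟩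
    rw [worstDist, Real.iSup_of_isEmpty]
    norm_num

/-- If path coupling gains `c` per unit of time, flip dynamics mixes in time `O(n k log n / c)`. -/
theorem flipMixesWithin_of_gain {Δ : ℕ} (hV : Nonempty V)
    (hΔ : ∀ w, (Finset.univ.filter (G.Adj w)).card ≤ Δ) (hk : Δ < k) {γ T c : ℝ} (hγ : 0 ≤ γ)
    (hγ' : γ * (16 / 15 * Δ) ≤ 1 / 2) (hc : 0 < c) (hck : c < k) (hT₀ : 0 ≤ T)
    (hTc : T * Δ ≤ k - c)
    (hT : ∀ N : ℕ, 11 / 6 - 1 / 264 * (if N ≠ 1 ∧ N ≠ 2 then 1 else 0)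
      + γ * ((k + 2 * Δ) * discount N + (discount N - discount (N + 1)) * (2 * Δ)
        - (if N = 0 then 0 else (discount (N - 1) - discount N) * (k - Δ - 2))) ≤ T) :
    FlipMixesWithin G k pStar
      ((Fintype.card V : ℝ) * k * Real.log (8 * Fintype.card V) / c + 1) := by
  have hn : Fintype.card V ≠ 0 := Fintype.card_ne_zero
  have hk₀ : k ≠ 0 := by omega
  have hn1 : (1 : ℝ) ≤ Fintype.card V := by exact_mod_cast Nat.pos_of_ne_zero hn
  have hkpos : (0 : ℝ) < k := by exact_mod_cast Nat.pos_of_ne_zero hk₀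
  have hnk : 0 < (Fintype.card V : ℝ) * k := by positivity
  have hlog : 0 ≤ Real.log (8 * Fintype.card V) := Real.log_nonneg (by linarith)
  set t := ⌈(Fintype.card V : ℝ) * k * Real.log (8 * Fintype.card V) / c⌉₊ with ht
  refine flipMixesWithin_of_worstDist_le (t := t) ?_ (Nat.ceil_lt_add_one (by positivity)).le
  refine worstDist_le_of_contraction hn hk₀ (exists_isProper hΔ hk) (d := edgeWeight G γ)
    (edgeWeight_le_one hγ) (fun σ v s => ?_) (κ := c / ((Fintype.card V : ℝ) * k)) ?_ ?_ ?_
  · have := le_edgeWeight hγ hΔ σ v s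
    linarith
  · rw [div_lt_one hnk]
    nlinarith
  · intro f hf σ v s hs
    have h := differAt_update hs
    have hgen := h.gen_sub_gen_le_of_forall hΔ hγ hT hf
    rw [Function.update_self] at hgen
    have hdeg : T * (Finset.univ.filter (G.Adj v)).card ≤ k - c := by
      refine le_trans (mul_le_mul_of_nonneg_left ?_ hT₀) hTc
      exact_mod_cast hΔ v
    have hd := edgeWeight_le_one (G := G) hγ σ v s
    have h₁ : gen G f σ / ((Fintype.card V : ℝ) * k)
        - gen G f (Function.update σ v s) / ((Fintype.card V : ℝ) * k)
        ≤ edgeWeight G γ σ v s - (f σ - f (Function.update σ v s))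
          - c / ((Fintype.card V : ℝ) * k) := by
      rw [← sub_div, div_le_iff₀ hnk, sub_mul, div_mul_cancel₀ _ hnk.ne']
      linarith
    have h₂ : c / ((Fintype.card V : ℝ) * k) * edgeWeight G γ σ v s
        ≤ c / ((Fintype.card V : ℝ) * k) := mul_le_of_le_one_right (by positivity) hd
    dsimp only
    linarith
  · have := Nat.le_ceil ((Fintype.card V : ℝ) * k * Real.log (8 * Fintype.card V) / c)
    rw [← ht] at this
    rw [div_mul_eq_mul_div, le_div_iff₀ hnk]
    rw [div_le_iff₀ hc] at this
    linarith

theorem flipMixesWithin_of_six_le {Δ : ℕ} (hV : Nonempty V)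
    (hΔ : ∀ w, (Finset.univ.filter (G.Adj w)).card ≤ Δ) (h6 : 6 ≤ Δ)
    (hk : ((11 : ℝ) / 6 - 1 / 84000) * Δ ≤ k) :
    FlipMixesWithin G k pStar ((Fintype.card V : ℝ) * k * Real.log (8 * Fintype.card V)
      / (Δ / 200000) + 1) := by
  have hD : (6 : ℝ) ≤ Δ := by exact_mod_cast h6
  have hD0 : (0 : ℝ) < Δ := by linarith
  have hkΔ : Δ < k := by
    have : (Δ : ℝ) < k := by linarith
    exact_mod_cast this
  obtain ⟨x, hx⟩ : ∃ x : ℝ, (k : ℝ) = x * Δ := ⟨k / Δ, by field_simp⟩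
  obtain ⟨i, hi⟩ : ∃ i : ℝ, (2 : ℝ) = i * Δ := ⟨2 / Δ, by field_simp⟩
  have hx' : (11 : ℝ) / 6 - 1 / 84000 ≤ x := by
    rw [hx] at hk
    exact le_of_mul_le_mul_right hk hD0
  have hi' : i ≤ 1 / 3 := by
    by_contra! hcon
    nlinarith
  -- At `k = (11/6)Δ` and `Δ = 6`, the discount terms gain `1/15300` for `N = 1` and `1/51000` for
  -- `N = 2`; the latter has to exceed `1/84000 + 1/200000`. For `N = 0` they cost about
  -- `6.09/1700`, less than `1/264`. The condition `Δ ≥ 6` bounds the error `i = 2/Δ` in the calming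
  -- rate by `1/3`.
  refine flipMixesWithin_of_gain hV hΔ hkΔ (γ := 1 / (1700 * Δ)) (T := x - 1 / 200000)
    (by positivity) ?_ (by positivity) (by linarith) (by linarith) (by rw [hx]; linarith) ?_
  · rw [div_mul_eq_mul_div, div_le_iff₀ (by positivity)]
    linarith
  · intro N
    have hγ : ∀ y : ℝ, 1 / (1700 * (Δ : ℝ)) * (y * Δ) = y / 1700 := by
      intro y; field_simp
    rcases (by omega : N = 0 ∨ N = 1 ∨ N = 2 ∨ 3 ≤ N) with rfl | rfl | rfl | hN
    · have : ((k : ℝ) + 2 * Δ) * discount 0 + (discount 0 - discount (0 + 1)) * (2 * Δ)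
          - (if (0 : ℕ) = 0 then 0 else (discount (0 - 1) - discount 0) * (k - Δ - 2))
          = ((x + 2) * (16 / 15) + 2) * Δ := by
        rw [hx]; norm_num [discount]; ring
      rw [this, hγ]
      norm_num
      linarith
    · have : ((k : ℝ) + 2 * Δ) * discount 1 + (discount 1 - discount (1 + 1)) * (2 * Δ)
          - (if (1 : ℕ) = 0 then 0 else (discount (1 - 1) - discount 1) * (k - Δ - 2))
          = ((x + 2) / 15 + 2 / 15 - (x - 1 - i)) * Δ := by
        rw [if_neg one_ne_zero]
        norm_num [discount]
        linarith
      rw [this, hγ]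
      norm_num
      linarith
    · have : ((k : ℝ) + 2 * Δ) * discount 2 + (discount 2 - discount (2 + 1)) * (2 * Δ)
          - (if (2 : ℕ) = 0 then 0 else (discount (2 - 1) - discount 2) * (k - Δ - 2))
          = (- (x - 1 - i) / 15) * Δ := by
        rw [if_neg two_ne_zero]
        norm_num [discount]
        linarith
      rw [this, hγ]
      norm_num
      linarith
    · rw [discount_of_le (by omega : 2 ≤ N), discount_of_le (by omega : 2 ≤ N + 1),
        discount_of_le (by omega : 2 ≤ N - 1), if_pos ⟨by omega, by omega⟩]
      simp
      linarith

theorem flipMixesWithin_of_lt_six {Δ : ℕ} (hV : Nonempty V)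
    (hΔ : ∀ w, (Finset.univ.filter (G.Adj w)).card ≤ Δ) (h6 : Δ < 6) (hk₀ : k ≠ 0)
    (hk : ((11 : ℝ) / 6 - 1 / 84000) * Δ ≤ k) :
    FlipMixesWithin G k pStar ((Fintype.card V : ℝ) * k * Real.log (8 * Fintype.card V)
      / (1 / 6) + 1) := by
  have h₁ : 11 * Δ < 6 * k + 1 := by
    have : (Δ : ℝ) < 6 := by exact_mod_cast h6
    have : (11 : ℝ) * Δ < 6 * k + 1 := by linarith
    exact_mod_cast this
  -- Equality `11 Δ = 6 k` would make `Δ` a multiple of `6`, so `Δ = 0` and `k = 0`. Integrality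
  -- thus yields a gain of `1/6` without any discount.
  have h₂ : 11 * Δ + 1 ≤ 6 * k := by omega
  have h₃ : (11 : ℝ) * Δ + 1 ≤ 6 * k := by exact_mod_cast h₂
  have hk1 : (1 : ℝ) ≤ k := by exact_mod_cast Nat.pos_of_ne_zero hk₀
  refine flipMixesWithin_of_gain hV hΔ (by omega) (γ := 0) (T := 11 / 6) le_rfl (by norm_num)
    (by norm_num) (by linarith) (by norm_num) (by linarith) ?_
  intro N
  split_ifs <;> norm_num

theorem card_filter_adj_le [DecidableRel G.Adj] {Δ : ℕ} (h : G.maxDegree ≤ Δ) (w : V) :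
    (@Finset.filter V (G.Adj w) (fun _ => Classical.propDecidable _) Finset.univ).card ≤ Δ := by
  refine le_trans (le_of_eq ?_) ((G.degree_le_maxDegree w).trans h)
  rw [← SimpleGraph.card_neighborFinset_eq_degree]
  congr 1
  ext z
  simp

/-- Since `n ≥ 1`, `log 2` is at most half of `log (4n)`. -/
theorem log_eight_mul_le {n : ℝ} (hn : 1 ≤ n) :
    Real.log (8 * n) ≤ 3 / 2 * Real.log (4 * n) ∧ 1 ≤ Real.log (4 * n) := by
  have h₂ : Real.log (8 * n) = Real.log 2 + Real.log (4 * n) := by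
    rw [← Real.log_mul (by norm_num) (by linarith)]; ring_nf
  have h₄ : 2 * Real.log 2 ≤ Real.log (4 * n) := by
    rw [show 2 * Real.log 2 = Real.log (2 ^ 2) by rw [Real.log_pow]; norm_num]
    exact Real.log_le_log (by norm_num) (by linarith)
  have := Real.log_two_gt_d9
  constructor <;> linarith

end Dynamics

end FlipDynamics

end

/-! ### The main theorem -/

open FlipDynamics in
theorem mainTheorem2 :
    FlipDynamics.IsFlipParameters FlipDynamics.pStar ∧
    FlipDynamics.IsBounded FlipDynamics.pStar ∧
    (∃ Δ₀ : ℕ, ∀ (V : Type u) [Fintype V] (G : SimpleGraph V) [DecidableRel G.Adj] (Δ k : ℕ),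
      Δ₀ ≤ Δ → G.maxDegree ≤ Δ → ((11 : ℝ) / 6 - 1 / 84000) * (Δ : ℝ) ≤ (k : ℝ) →
        FlipDynamics.FlipMixesWithin G k FlipDynamics.pStar
          ((k : ℝ) * (Fintype.card V : ℝ) * Real.log (4 * (Fintype.card V : ℝ)))) ∧
    (∃ C : ℝ, ∀ (V : Type u) [Fintype V] (G : SimpleGraph V) [DecidableRel G.Adj] (Δ k : ℕ),
      G.maxDegree ≤ Δ → ((11 : ℝ) / 6 - 1 / 84000) * (Δ : ℝ) ≤ (k : ℝ) →
        FlipDynamics.FlipMixesWithin G k FlipDynamics.pStar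
          (C * ((k : ℝ) * (Fintype.card V : ℝ) * Real.log (4 * (Fintype.card V : ℝ))))) := by
  have bound : ∀ {n k ℓ ℓ' : ℝ}, 1 ≤ n → 1 ≤ k → 1 ≤ ℓ → ℓ' ≤ 3 / 2 * ℓ →
      1 ≤ k * n * ℓ ∧ n * k * ℓ' ≤ 3 / 2 * (k * n * ℓ) := by
    intro n k ℓ ℓ' hn hk hℓ hℓ'
    have hkn : 1 ≤ k * n := one_le_mul_of_one_le_of_one_le hk hn
    refine ⟨one_le_mul_of_one_le_of_one_le hkn hℓ, ?_⟩
    have := mul_le_mul_of_nonneg_left hℓ' (by linarith : 0 ≤ k * n)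
    linarith
  -- Put `B = k n log(4n)`. For `Δ ≥ 1200000` the gain `Δ/200000` is at least `6` and `B ≥ 2`, so
  -- the time is at most `B/4 + 1 ≤ B`. For `6 ≤ Δ` the gain is at least `6/200000`, so the time is
  -- at most `50000 B + 1`; `1000000` is a generous constant.
  refine ⟨isFlipParameters_pStar, isBounded_pStar, ⟨1200000, ?_⟩, ⟨1000000, ?_⟩⟩
  · intro V _ G _ Δ k hΔ₀ hdeg hk
    by_cases hV : IsEmpty V ∨ k = 0
    · refine (flipMixesWithin_zero pStar hV).mono (le_of_eq ?_)
      rcases hV with hV | rfl <;> simp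
    rw [not_or, not_isEmpty_iff] at hV
    have hD : (1200000 : ℝ) ≤ Δ := by simpa using Nat.cast_le (α := ℝ).2 hΔ₀
    have h6 : 6 ≤ Δ := by
      have : (6 : ℝ) ≤ Δ := by linarith
      exact_mod_cast this
    have hn : (1 : ℝ) ≤ Fintype.card V := by
      have := hV.1
      exact_mod_cast Fintype.card_pos
    obtain ⟨hl, hl'⟩ := log_eight_mul_le hn
    obtain ⟨_, hb⟩ := bound hn (by linarith : (1 : ℝ) ≤ k) hl' hl
    have hb' : (2 : ℝ) ≤ k * Fintype.card V * Real.log (4 * Fintype.card V) := by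
      have h₁ := (bound (k := (k : ℝ) / 2) hn (by linarith) hl' hl).1
      linarith
    refine (flipMixesWithin_of_six_le hV.1 (card_filter_adj_le hdeg) h6 hk).mono ?_
    have h₁ : (Fintype.card V : ℝ) * k * Real.log (8 * Fintype.card V) / (Δ / 200000)
        ≤ (Fintype.card V : ℝ) * k * Real.log (8 * Fintype.card V) / 6 :=
      div_le_div_of_nonneg_left (mul_nonneg (by positivity) (Real.log_nonneg (by linarith)))
        (by norm_num) (by linarith)
    linarith
  · intro V _ G _ Δ k hdeg hk
    by_cases hV : IsEmpty V ∨ k = 0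
    · refine (flipMixesWithin_zero pStar hV).mono (le_of_eq ?_)
      rcases hV with hV | rfl <;> simp
    rw [not_or, not_isEmpty_iff] at hV
    have hk1 : (1 : ℝ) ≤ k := by exact_mod_cast Nat.pos_of_ne_zero hV.2
    have hn : (1 : ℝ) ≤ Fintype.card V := by
      have := hV.1
      exact_mod_cast Fintype.card_pos
    obtain ⟨hl, hl'⟩ := log_eight_mul_le hn
    obtain ⟨hb', hb⟩ := bound hn hk1 hl' hl
    rcases lt_or_ge Δ 6 with h6 | h6
    · refine (flipMixesWithin_of_lt_six hV.1 (card_filter_adj_le hdeg) h6 hV.2 hk).mono ?_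
      linarith
    · refine (flipMixesWithin_of_six_le hV.1 (card_filter_adj_le hdeg) h6 hk).mono ?_
      have hD : (6 : ℝ) ≤ Δ := by exact_mod_cast h6
      have h₁ : (Fintype.card V : ℝ) * k * Real.log (8 * Fintype.card V) / (Δ / 200000)
          ≤ (Fintype.card V : ℝ) * k * Real.log (8 * Fintype.card V) / (6 / 200000) :=
        div_le_div_of_nonneg_left (mul_nonneg (by positivity) (Real.log_nonneg (by linarith)))
          (by norm_num) (by linarith)
      linarith
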